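/- For real $\nu$ and $x>0$ let $J_\nu(x)=\sum_{k\ge 0}\frac{(-1)^k}{k!\,\Gamma(k+\nu+1)}\left(\frac{x}{2}\right)^{2k+\nu}$ (with $1/\Gamma=0$ at the poles of $\Gamma$) be the Bessel function of the first kind, and let $Y_\nu(x)=\frac{J_\nu(x)\cos(\nu\pi)-J_{-\nu}(x)}{\sin(\nu\pi)}$ (for integer $\nu$: the limit of this quotient as the order tends to $\nu$) be the Bessel function of the second kind. Let $\alpha\ge -\frac12$, let $X_\alpha$ be the first positive zero of $J_\alpha+Y_\alpha$, and define the modulus function $$M_\alpha(x)=\begin{cases}\left(2|Y_\alpha(x)|\,|J_\alpha(x)|\right)^{1/2} & \text{if } 0<x\le X_\alpha,\\ \left(J_\alpha^2(x)+Y_\alpha^2(x)\right)^{1/2} & \text{if } x\ge X_\alpha\end{cases}$$ (the two formulas agree at $x=X_\alpha$). Then $x\mapsto xM_\alpha^2(x)$ is bounded above on $(0,\infty)$ and $$\sup_{x>0} xM_\alpha^2(x)\le m_\alpha,\qquad m_\alpha=\begin{cases}\dfrac{2}{\pi} & \text{if } |\alpha|\le\frac12,\\[2mm] \max\left(-2\alpha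 J_\alpha(\alpha)Y_\alpha(\alpha)+\dfrac{4\alpha}{\pi},\ \alpha\left(J_\alpha^2(\alpha)+Y_\alpha^2(\alpha)\right)\right) & \text{if } \alpha>\frac12.\end{cases}$$ -/

import Mathlib

open Set Filter Topology

noncomputable section

/-- The Bessel function of the first kind `J_ν(x)` of real order `ν`, for `x > 0`:
`J_ν(x) = ∑ (-1)^k / (k! Γ(k + ν + 1)) (x / 2)^(2k + ν)`.
At the poles of the Gamma function Mathlib has `Γ = 0` and `1 / 0 = 0`, so the usual convention
`1 / Γ(-n) = 0` holds. -/
def besselJ (ν x : ℝ) : ℝ :=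
  ∑' k : ℕ, (-1 : ℝ) ^ k / ((k.factorial : ℝ) * Real.Gamma ((k : ℝ) + ν + 1)) *
    (x / 2) ^ (2 * (k : ℝ) + ν)

/-- The quotient `(J_ν(x) cos(νπ) - J_{-ν}(x)) / sin(νπ)`, meaningful for non-integer `ν`. -/
def besselYQuot (ν x : ℝ) : ℝ :=
  (besselJ ν x * Real.cos (ν * Real.pi) - besselJ (-ν) x) / Real.sin (ν * Real.pi)

open Classical in
/-- The Bessel function of the second kind `Y_ν(x)` of real order `ν`, for `x > 0`:
the quotient `besselYQuot ν x` when `ν` is not an integer, and the limit of this quotient as the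
order tends to `ν` when `ν` is an integer. -/
def besselY (ν x : ℝ) : ℝ :=
  if ∃ n : ℤ, (n : ℝ) = ν then limUnder (𝓝[≠] ν) (fun μ : ℝ => besselYQuot μ x)
  else besselYQuot ν x

/-- `X_α`, the first positive zero of `J_α + Y_α`. -/
def besselX (α : ℝ) : ℝ :=
  sInf {x : ℝ | 0 < x ∧ besselJ α x + besselY α x = 0}

/-- The modulus function `M_α` of `J_α` and `Y_α`, for `x > 0`.
On `(0, X_α]` it is `(2 |Y_α| J_α)^(1/2)`; the absolute value around `J_α` has an effect only where
`J_α < 0`, which can happen on `(0, X_α]` only for `α ≤ -1/4`, and there it keeps the radicand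
nonnegative. -/
def besselModulus (α x : ℝ) : ℝ :=
  if x ≤ besselX α then Real.sqrt (2 * |besselY α x| * |besselJ α x|)
  else Real.sqrt (besselJ α x ^ 2 + besselY α x ^ 2)

/-- The constant `m_α`, for `α ≥ -1/2`. -/
def modulusBound (α : ℝ) : ℝ :=
  if |α| ≤ 1 / 2 then 2 / Real.pi
  else max (-2 * α * besselJ α α * besselY α α + 4 * α / Real.pi)
    (α * (besselJ α α ^ 2 + besselY α α ^ 2))

end

open MeasureTheory

/-! Since `2|Y||J| ≤ J² + Y²`, the quantity `x M²` never exceeds `x (J² + Y²) = u₁² + u₂²`, where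
`u₁ = √x J` and `u₂ = √x Y` solve `u'' + q u = 0` with `q(x) = 1 - (α² - 1/4)/x²`. At infinity `u₁²
+ u₂²` tends to `2/π`, which is also the Wronskian of the pair.

If `|α| ≤ 1/2`, then `q` is nonincreasing. The energy of the solution vanishing at a given point is
nonincreasing, and comparing its value there with its limit gives `u₁² + u₂² ≤ 2/π`
(`IsPhasePair.sq_add_sq_le`).

If `α > 1/2`, then `q` is increasing and concave, and `u₁² + u₂²` is nonincreasing on `(0, ∞)`
(`IsPhasePair.antitoneOn_sq_add_sq`), so on `[α, ∞)` it is at most its value at `α`. On `(0, α)`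
this is useless, as `Y` blows up at `0`. There the first branch of the modulus applies, because `α ≤
X_α` (`order_le_besselX`), and `-2xJY + 4x/π` is nondecreasing: by the Wronskian its derivative is
`-2JY - 4xJ'Y`, with `J > 0`, `J' ≥ 0`, `Y < 0` (`neg_two_mul_besselJ_mul_besselY_le`).

The inequality `α ≤ X_α` rests on `J_α(α) + Y_α(α) ≤ 0` (`besselJ_add_besselY_self_nonpos`), since
`Y/J` increases on `(0, α]`. That inequality is read off a contour integral along the steepest
descent path of `sinh w - w` from `0`.

The analytic facts about `J` and `Y` all come from one function, `π i (J + i Y)`, the integral of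
`exp (x sinh w - ν w)` from `-∞` to `∞ + π i`. The series for `J` is tied to it through Hankel's
integral for `1/Γ` and Schläfli's integrals. Moving the contour to the steepest descent path through
`π i / 2` then yields smoothness, Bessel's equation and the behaviour at infinity, uniformly in
whether `ν` is an integer. -/

/-! ### Hankel's contour integral for the reciprocal Gamma function -/

theorem integrable_exp_neg_sq_add_abs {c : ℝ} (hc : 0 < c) (b : ℝ) :
    Integrable fun u : ℝ => Real.exp (-c * u ^ 2 + b * |u|) := by
  have h := (integrable_exp_neg_mul_sq (half_pos hc)).const_mul (Real.exp (b ^ 2 / (2 * c)))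
  refine h.mono' (by fun_prop) (Eventually.of_forall fun u => ?_)
  rw [Real.norm_of_nonneg (Real.exp_pos _).le, ← Real.exp_add]
  refine Real.exp_le_exp.mpr ?_
  have h1 : b ^ 2 / (2 * c) + -(c / 2) * u ^ 2 - (-c * u ^ 2 + b * |u|)
      = (c * |u| - b) ^ 2 / (2 * c) := by
    rw [sub_sq, mul_pow, sq_abs]; field_simp; ring
  have h2 : 0 ≤ (c * |u| - b) ^ 2 / (2 * c) := by positivity
  linarith

/-- The circular part of Hankel's contour integral for `1 / Γ`. -/
noncomputable def hankelCircle (r z : ℝ) : ℝ :=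
  ∫ θ in (0 : ℝ)..Real.pi, Real.exp (r * Real.cos θ) * Real.cos (r * Real.sin θ - z * θ)

/-- The radial part of Hankel's contour integral for `1 / Γ`, in logarithmic coordinates. -/
noncomputable def hankelRay (r z : ℝ) : ℝ :=
  ∫ u in Ioi (0 : ℝ), Real.exp (-(r * Real.exp u) - z * u)

theorem exp_neg_mul_exp_sub_le {r : ℝ} (hr : 0 < r) (z : ℝ) {u : ℝ} (hu : 0 ≤ u) :
    Real.exp (-(r * Real.exp u) - z * u) ≤ Real.exp (-(r / 2) * u ^ 2 + |z| * |u|) := by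
  refine Real.exp_le_exp.mpr ?_
  have h1 := Real.quadratic_le_exp_of_nonneg hu
  have h2 : -z * u ≤ |z| * |u| := by
    rw [← abs_mul]; exact (le_abs_self _).trans (by rw [neg_mul, abs_neg])
  nlinarith

theorem integrableOn_hankelRay {r : ℝ} (hr : 0 < r) (z : ℝ) :
    IntegrableOn (fun u : ℝ => Real.exp (-(r * Real.exp u) - z * u)) (Ioi 0) := by
  refine (integrable_exp_neg_sq_add_abs (half_pos hr) |z|).integrableOn.mono' (by fun_prop) ?_
  refine (ae_restrict_iff' measurableSet_Ioi).mpr (Eventually.of_forall fun u hu => ?_)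
  rw [Real.norm_of_nonneg (Real.exp_pos _).le]
  exact exp_neg_mul_exp_sub_le hr z (le_of_lt hu)

theorem integrableOn_Iic_exp_neg_mul_exp {r z : ℝ} (hr : 0 < r) (hz : z < 0) :
    IntegrableOn (fun u : ℝ => Real.exp (-(r * Real.exp u) - z * u)) (Iic 0) := by
  refine (integrableOn_exp_mul_Iic (neg_pos.mpr hz) 0).mono' (by fun_prop) ?_
  refine Eventually.of_forall fun u => ?_
  rw [Real.norm_of_nonneg (Real.exp_pos _).le]
  refine Real.exp_le_exp.mpr ?_
  have : 0 < r * Real.exp u := by positivity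
  linarith

theorem integral_exp_neg_mul_exp {r z : ℝ} (hr : 0 < r) (hz : z < 0) :
    ∫ u : ℝ, Real.exp (-(r * Real.exp u) - z * u) = r ^ z * Real.Gamma (-z) := by
  have h := Real.integral_rpow_mul_exp_neg_mul_Ioi (neg_pos.mpr hz) hr
  have himg : Real.exp '' univ = Ioi 0 := by rw [image_univ, Real.range_exp]
  rw [← himg, integral_image_eq_integral_abs_deriv_smul MeasurableSet.univ
    (fun x _ => (Real.hasDerivAt_exp x).hasDerivWithinAt) Real.exp_injective.injOn] at h
  rw [setIntegral_univ] at h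
  have h2 : (1 / r) ^ (-z) = r ^ z := by
    rw [one_div, Real.inv_rpow hr.le, Real.rpow_neg hr.le, inv_inv]
  rw [h2] at h
  rw [← h]
  congr 1
  ext u
  rw [abs_of_pos (Real.exp_pos u), smul_eq_mul, ← Real.exp_mul, ← Real.exp_add, ← Real.exp_add]
  congr 1; ring

/-- Cauchy's theorem for `exp (r e^w - z w)` on the rectangle `[-R, 0] × [0, π]`, imaginary part.
The integrand is real on the bottom edge, which therefore drops out; the top edge carries the factor
`sin (π z)`, and the right edge is the circle. -/
theorem hankelCircle_eq_rect (r z R : ℝ) :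
    hankelCircle r z = -Real.sin (Real.pi * z) *
        (∫ u in (-R)..0, Real.exp (-(r * Real.exp u) - z * u)) +
      ∫ θ in (0 : ℝ)..Real.pi, Real.exp (r * Real.exp (-R) * Real.cos θ + z * R) *
        Real.cos (r * Real.exp (-R) * Real.sin θ - z * θ) := by
  have H := Complex.integral_boundary_rect_eq_zero_of_differentiableOn
    (fun w : ℂ => Complex.exp (r * Complex.exp w - z * w)) (-R : ℝ) (Real.pi * Complex.I)
    (by fun_prop)
  have H' := congrArg Complex.im H
  simp only [Complex.ofReal_re, Complex.ofReal_im, Complex.mul_re, Complex.I_re, mul_zero,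
    Complex.I_im, mul_one, sub_zero, zero_mul, Complex.mul_im, add_zero,
    smul_eq_mul, Complex.zero_im, Complex.add_im, Complex.sub_im, Complex.ofReal_zero,
    one_mul, zero_add] at H'
  have im_int : ∀ (f : ℝ → ℂ) (a b : ℝ), Continuous f →
      (∫ x in a..b, f x).im = ∫ x in a..b, (f x).im := fun f a b hf =>
    (Complex.imCLM.intervalIntegral_comp_comm (hf.intervalIntegrable a b)).symm
  have re_int : ∀ (f : ℝ → ℂ) (a b : ℝ), Continuous f →
      (∫ x in a..b, f x).re = ∫ x in a..b, (f x).re := fun f a b hf =>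
    (Complex.reCLM.intervalIntegral_comp_comm (hf.intervalIntegrable a b)).symm
  rw [im_int _ _ _ (by fun_prop), im_int _ _ _ (by fun_prop), re_int _ _ _ (by fun_prop),
    re_int _ _ _ (by fun_prop)] at H'
  have e1 : ∀ x : ℝ, (Complex.exp (r * Complex.exp x - z * x)).im = 0 := fun x => by
    rw [← Complex.ofReal_exp, ← Complex.ofReal_mul, ← Complex.ofReal_mul, ← Complex.ofReal_sub,
      ← Complex.ofReal_exp, Complex.ofReal_im]
  have e2 : ∀ x : ℝ, (Complex.exp (r * Complex.exp (x + Real.pi * Complex.I)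
      - z * (x + Real.pi * Complex.I))).im
      = -Real.sin (Real.pi * z) * Real.exp (-(r * Real.exp x) - z * x) := fun x => by
    rw [Complex.exp_im]
    simp [Complex.exp_re, Complex.exp_im]
    rw [mul_comm z Real.pi]; ring
  have e3 : ∀ R θ : ℝ, (Complex.exp (r * Complex.exp ((-R : ℝ) + θ * Complex.I)
      - z * ((-R : ℝ) + θ * Complex.I))).re
      = Real.exp (r * Real.exp (-R) * Real.cos θ + z * R) *
        Real.cos (r * Real.exp (-R) * Real.sin θ - z * θ) := fun R θ => by
    rw [Complex.exp_re]
    simp [Complex.exp_re, Complex.exp_im]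
    simp only [mul_assoc]
  have e4 : ∀ θ : ℝ, (Complex.exp (r * Complex.exp (θ * Complex.I)
      - z * (θ * Complex.I))).re
      = Real.exp (r * Real.cos θ) * Real.cos (r * Real.sin θ - z * θ) := fun θ => by
    rw [Complex.exp_re]
    simp [Complex.exp_re, Complex.exp_im]
  simp only [e1, e2, e3, e4] at H'
  rw [intervalIntegral.integral_const_mul] at H'
  simp only [intervalIntegral.integral_zero] at H'
  rw [hankelCircle]
  linarith

/-- For `z < 0` the left edge of the rectangle vanishes as `R → ∞`. The circle is thus a ray
integral over `(-∞, 0]`, which the other ray completes to Euler's integral for `Γ(-z)`; the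
reflection formula finishes. -/
theorem hankelCircle_sub_eq_of_neg {r z : ℝ} (hr : 0 < r) (hz : z < 0) :
    hankelCircle r z - Real.sin (Real.pi * z) * hankelRay r z =
      Real.pi * (r ^ z / Real.Gamma (z + 1)) := by
  have hlim : Tendsto (fun R : ℝ => -Real.sin (Real.pi * z) *
        (∫ u in (-R)..0, Real.exp (-(r * Real.exp u) - z * u)) +
      ∫ θ in (0 : ℝ)..Real.pi, Real.exp (r * Real.exp (-R) * Real.cos θ + z * R) *
        Real.cos (r * Real.exp (-R) * Real.sin θ - z * θ)) atTop
      (𝓝 (-Real.sin (Real.pi * z) *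
        (∫ u in Iic 0, Real.exp (-(r * Real.exp u) - z * u)) + 0)) := by
    refine ((intervalIntegral_tendsto_integral_Iic 0 (integrableOn_Iic_exp_neg_mul_exp hr hz)
      tendsto_neg_atTop_atBot).const_mul _).add ?_
    have hb : Tendsto (fun R : ℝ => Real.exp (r + z * R) * |Real.pi - 0|) atTop (𝓝 0) := by
      have : Tendsto (fun R : ℝ => r + z * R) atTop atBot :=
        tendsto_atBot_add_const_left _ _ (tendsto_id.const_mul_atTop_of_neg hz)
      simpa using (Real.tendsto_exp_atBot.comp this).mul_const |Real.pi - 0|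
    refine squeeze_zero_norm' ?_ hb
    filter_upwards [eventually_ge_atTop 0] with R hR
    refine intervalIntegral.norm_integral_le_of_norm_le_const fun θ _ => ?_
    rw [norm_mul, Real.norm_of_nonneg (Real.exp_pos _).le]
    have h1 : Real.exp (r * Real.exp (-R) * Real.cos θ + z * R) ≤ Real.exp (r + z * R) := by
      refine Real.exp_le_exp.mpr ?_
      have h3 : Real.exp (-R) ≤ 1 := Real.exp_le_one_iff.mpr (by linarith)
      have h4 : r * Real.exp (-R) * Real.cos θ ≤ r * Real.exp (-R) * 1 :=
        mul_le_mul_of_nonneg_left (Real.cos_le_one θ) (by positivity)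
      nlinarith
    have h2 : ‖Real.cos (r * Real.exp (-R) * Real.sin θ - z * θ)‖ ≤ 1 := Real.abs_cos_le_one _
    calc _ ≤ Real.exp (r + z * R) * 1 :=
          mul_le_mul h1 h2 (norm_nonneg _) (Real.exp_pos _).le
      _ = _ := mul_one _
  have hconst := tendsto_nhds_unique
    ((tendsto_const_nhds (x := hankelCircle r z)).congr fun R => hankelCircle_eq_rect r z R) hlim
  have hsplit := integral_exp_neg_mul_exp hr hz
  have hint : Integrable fun u : ℝ => Real.exp (-(r * Real.exp u) - z * u) := by
    rw [← integrableOn_univ, ← Iic_union_Ioi (a := (0 : ℝ))]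
    exact (integrableOn_Iic_exp_neg_mul_exp hr hz).union (integrableOn_hankelRay hr z)
  rw [← intervalIntegral.integral_Iic_add_Ioi hint.integrableOn hint.integrableOn (b := 0)]
    at hsplit
  have href := Real.Gamma_mul_Gamma_one_sub (-z)
  rw [mul_neg, Real.sin_neg, sub_neg_eq_add, add_comm 1 z] at href
  have key : hankelCircle r z - Real.sin (Real.pi * z) * hankelRay r z =
      -Real.sin (Real.pi * z) * (r ^ z * Real.Gamma (-z)) := by
    rw [hconst, ← hsplit, hankelRay]; ring
  rw [key]
  by_cases hs : Real.sin (Real.pi * z) = 0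
  -- At a negative integer the right side of the reflection formula is a division by zero, hence
  -- `0`, which forces the default value `Γ(z + 1) = 0`; both sides then vanish.
  · rw [hs] at href ⊢
    have hG : Real.Gamma (-z) ≠ 0 := (Real.Gamma_pos_of_pos (neg_pos.mpr hz)).ne'
    have : Real.Gamma (z + 1) = 0 := by simpa [hG] using href
    simp [this]
  · have hne : Real.Gamma (z + 1) ≠ 0 := by
      intro h0
      rw [h0, mul_zero] at href
      exact (div_ne_zero Real.pi_ne_zero (neg_ne_zero.mpr hs)) href.symm
    rw [eq_div_iff (neg_ne_zero.mpr hs)] at href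
    rw [← mul_div_assoc, eq_div_iff hne]
    linear_combination r ^ z * href

/-- The value `z = 0` needs its own argument: the left edge does not vanish but tends to `π`, and
the recurrence from `z - 1` to `z` loses its information at `z = 0`. -/
theorem hankelCircle_zero (r : ℝ) : hankelCircle r 0 = Real.pi := by
  have hlim : Tendsto (fun R : ℝ => ∫ θ in (0 : ℝ)..Real.pi,
      Real.exp (r * Real.exp (-R) * Real.cos θ) * Real.cos (r * Real.exp (-R) * Real.sin θ)) atTop
      (𝓝 (∫ θ in (0 : ℝ)..Real.pi, 1)) := by
    have hc : Continuous fun s : ℝ => ∫ θ in (0 : ℝ)..Real.pi,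
        Real.exp (r * s * Real.cos θ) * Real.cos (r * s * Real.sin θ) := by
      apply intervalIntegral.continuous_parametric_intervalIntegral_of_continuous' (by fun_prop)
    have h := (hc.tendsto 0).comp (Real.tendsto_exp_neg_atTop_nhds_zero)
    simpa [Function.comp_def] using h
  have := tendsto_nhds_unique ((tendsto_const_nhds (x := hankelCircle r 0)).congr fun R => by
    simpa using hankelCircle_eq_rect r 0 R) hlim
  simpa using this

/-- Integration by parts. The boundary term is the one produced by the ray in the next recurrence,
so the two cancel in Hankel's combination and leave `Γ(z + 1) = z Γ(z)`. -/
theorem hankelCircle_recurrence (r z : ℝ) :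
    r * hankelCircle r (z - 1) - z * hankelCircle r z =
      -(Real.exp (-r) * Real.sin (Real.pi * z)) := by
  have hd : ∀ θ ∈ uIcc 0 Real.pi, HasDerivAt
      (fun θ => Real.exp (r * Real.cos θ) * Real.sin (r * Real.sin θ - z * θ))
      (r * (Real.exp (r * Real.cos θ) * Real.cos (r * Real.sin θ - (z - 1) * θ)) -
        z * (Real.exp (r * Real.cos θ) * Real.cos (r * Real.sin θ - z * θ))) θ := fun θ _ => by
    have h1 := ((Real.hasDerivAt_cos θ).const_mul r).exp
    have h2 := (((Real.hasDerivAt_sin θ).const_mul r).sub ((hasDerivAt_id θ).const_mul z)).sin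
    refine (h1.mul h2).congr_deriv ?_
    have h3 : r * Real.sin θ - (z - 1) * θ = (r * Real.sin θ - z * θ) + θ := by ring
    simp only [Pi.sub_apply, id]
    rw [h3, Real.cos_add]; ring
  have h := intervalIntegral.integral_eq_sub_of_hasDerivAt hd
    (Continuous.intervalIntegrable (by fun_prop) _ _)
  rw [intervalIntegral.integral_sub (Continuous.intervalIntegrable (by fun_prop) _ _)
    (Continuous.intervalIntegrable (by fun_prop) _ _), intervalIntegral.integral_const_mul,
    intervalIntegral.integral_const_mul] at h
  rw [hankelCircle, hankelCircle, h]
  simp [mul_comm z]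

theorem hankelRay_recurrence {r : ℝ} (hr : 0 < r) (z : ℝ) :
    r * hankelRay r (z - 1) + z * hankelRay r z = Real.exp (-r) := by
  have hd : ∀ u ∈ Ici (0 : ℝ), HasDerivAt (fun u => Real.exp (-(r * Real.exp u) - z * u))
      (-r * Real.exp (-(r * Real.exp u) - (z - 1) * u) +
        -z * Real.exp (-(r * Real.exp u) - z * u)) u := fun u _ => by
    have h1 := ((((Real.hasDerivAt_exp u).const_mul r).neg).sub
      ((hasDerivAt_id u).const_mul z)).exp
    refine h1.congr_deriv ?_
    have h3 : -(r * Real.exp u) - (z - 1) * u = (-(r * Real.exp u) - z * u) + u := by ring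
    simp only [Pi.sub_apply, Pi.neg_apply, id]
    rw [h3, Real.exp_add]; ring
  have hint := ((integrableOn_hankelRay hr (z - 1)).const_mul (-r)).add
    ((integrableOn_hankelRay hr z).const_mul (-z))
  have hlim : Tendsto (fun u => Real.exp (-(r * Real.exp u) - z * u)) atTop (𝓝 0) := by
    have h0 : Tendsto (fun u : ℝ => Real.exp (|z| ^ 2 / (2 * (r / 2)) + -u ^ 2 * (r / 4))) atTop
        (𝓝 0) := by
      refine Real.tendsto_exp_atBot.comp (tendsto_atBot_add_const_left _ _ ?_)
      refine Tendsto.atBot_mul_const (by positivity) ?_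
      exact tendsto_neg_atTop_atBot.comp (tendsto_pow_atTop two_ne_zero)
    refine squeeze_zero' (Eventually.of_forall fun u => (Real.exp_pos _).le) ?_ h0
    filter_upwards [eventually_ge_atTop 0] with u hu
    refine (exp_neg_mul_exp_sub_le hr z hu).trans (Real.exp_le_exp.mpr ?_)
    have h1 : |z| ^ 2 / (2 * (r / 2)) + -u ^ 2 * (r / 4) - (-(r / 2) * u ^ 2 + |z| * |u|)
        = (r / 2 * u - |z|) ^ 2 / r := by
      rw [abs_of_nonneg hu]; field_simp; ring
    have h2 : 0 ≤ (r / 2 * u - |z|) ^ 2 / r := by positivity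
    linarith
  have h := integral_Ioi_of_hasDerivAt_of_tendsto' hd hint hlim
  rw [integral_add ((integrableOn_hankelRay hr (z - 1)).const_mul (-r))
    ((integrableOn_hankelRay hr z).const_mul (-z)), integral_const_mul, integral_const_mul] at h
  simp only [Real.exp_zero, mul_one, mul_zero, sub_zero, zero_sub] at h
  rw [hankelRay, hankelRay]
  linarith

/-- Hankel's contour integral for the reciprocal of the Gamma function, in real form. -/
theorem hankelCircle_sub_eq {r : ℝ} (hr : 0 < r) (z : ℝ) :
    hankelCircle r z - Real.sin (Real.pi * z) * hankelRay r z =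
      Real.pi * (r ^ z / Real.Gamma (z + 1)) := by
  -- The recurrence lowers `z` by one until it reaches `z < 0` or `z = 0`; `n` only bounds the
  -- number of steps.
  obtain ⟨n, hn⟩ := exists_nat_gt z
  induction n generalizing z with
  | zero => exact hankelCircle_sub_eq_of_neg hr (by simpa using hn)
  | succ n ih =>
    rcases lt_trichotomy z 0 with hz | rfl | hz
    · exact hankelCircle_sub_eq_of_neg hr hz
    · simp [hankelCircle_zero]
    · have h := ih (z - 1) (by push_cast at hn; linarith)
      have h1 := hankelCircle_recurrence r z
      have h2 := hankelRay_recurrence hr z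
      have hs : Real.sin (Real.pi * (z - 1)) = -Real.sin (Real.pi * z) := by
        rw [mul_sub, mul_one, Real.sin_sub_pi]
      rw [hs, sub_add_cancel, Real.rpow_sub_one hr.ne'] at h
      rw [Real.Gamma_add_one hz.ne']
      have hG := (Real.Gamma_pos_of_pos hz).ne'
      have h3 : r * (hankelCircle r (z - 1) - -Real.sin (Real.pi * z) * hankelRay r (z - 1))
          = z * (Real.pi * (r ^ z / (z * Real.Gamma z))) := by
        rw [h]; field_simp
      refine mul_left_cancel₀ hz.ne' ?_
      rw [← h3]
      linear_combination -h1 - Real.sin (Real.pi * z) * h2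

/-! ### Schläfli's integrals for the Bessel functions -/

theorem hasSum_of_eq {f g : ℕ → ℝ} {a b : ℝ} (h : HasSum f a) (hfg : ∀ k, g k = f k)
    (hab : b = a) : HasSum g b := by
  rw [hab, funext hfg]; exact h

/-- Expanding `exp (-r e^{-iθ})` in powers of `r` and multiplying by `exp (r e^{iθ} - iνθ)` gives
`exp (i (2 r sin θ - νθ))`; the real part is integrated term by term. -/
theorem hasSum_hankelCircle (r ν : ℝ) :
    HasSum (fun k : ℕ => (-r) ^ k / k.factorial * hankelCircle r (ν + k))
      (∫ θ in (0 : ℝ)..Real.pi, Real.cos (2 * r * Real.sin θ - ν * θ)) := by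
  have h := intervalIntegral.hasSum_integral_of_dominated_convergence (μ := volume)
    (a := 0) (b := Real.pi)
    (F := fun (k : ℕ) θ => (-r) ^ k / k.factorial *
      (Real.exp (r * Real.cos θ) * Real.cos (r * Real.sin θ - (ν + k) * θ)))
    (f := fun θ => Real.cos (2 * r * Real.sin θ - ν * θ))
    (fun k _ => |r| ^ k / k.factorial * Real.exp |r|)
    (fun k => Continuous.aestronglyMeasurable (by fun_prop))
    (fun k => Eventually.of_forall fun θ _ => ?_)
    (Eventually.of_forall fun θ _ => (Real.summable_pow_div_factorial |r|).mul_right _)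
    (by
      simp_rw [tsum_mul_right]
      exact intervalIntegrable_const)
    (Eventually.of_forall fun θ _ => ?_)
  · exact hasSum_of_eq h (fun k => by simp only [intervalIntegral.integral_const_mul, hankelCircle]) rfl
  · rw [norm_mul, norm_div, norm_pow, norm_neg, Real.norm_natCast, Real.norm_eq_abs]
    refine mul_le_mul_of_nonneg_left ?_ (by positivity)
    rw [norm_mul, Real.norm_of_nonneg (Real.exp_pos _).le]
    have h1 : Real.exp (r * Real.cos θ) ≤ Real.exp |r| := by
      refine Real.exp_le_exp.mpr ((le_abs_self _).trans ?_)
      rw [abs_mul]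
      exact mul_le_of_le_one_right (abs_nonneg _) (Real.abs_cos_le_one θ)
    calc _ ≤ Real.exp |r| * 1 := mul_le_mul h1 (Real.abs_cos_le_one _) (abs_nonneg _)
          (Real.exp_pos _).le
      _ = _ := mul_one _
  · have hs := (NormedSpace.expSeries_div_hasSum_exp
      (-(r : ℂ) * Complex.exp (-(θ * Complex.I)))).mul_right
        (Complex.exp (r * Complex.exp (θ * Complex.I) - ν * (θ * Complex.I)))
    rw [← Complex.exp_eq_exp_ℂ, ← Complex.exp_add] at hs
    have hr := Complex.hasSum_re hs
    refine hasSum_of_eq hr (fun k => ?_) ?_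
    · rw [mul_pow, ← Complex.exp_nat_mul, mul_div_right_comm, mul_assoc, ← Complex.exp_add]
      have e : (k : ℂ) * -(θ * Complex.I) + (r * Complex.exp (θ * Complex.I)
          - ν * (θ * Complex.I)) =
          ((r * Real.cos θ : ℝ) : ℂ) + ((r * Real.sin θ - (ν + k) * θ : ℝ) : ℂ) * Complex.I := by
        rw [Complex.exp_mul_I]; push_cast; ring
      rw [e]
      have e2 : ((-(r : ℂ)) ^ k / (k.factorial : ℂ)) = (((-r) ^ k / k.factorial : ℝ) : ℂ) := by
        push_cast; rfl
      rw [e2, Complex.re_ofReal_mul, Complex.exp_add, ← Complex.ofReal_exp, Complex.re_ofReal_mul,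
        Complex.exp_ofReal_mul_I_re]
    · have e : -(r : ℂ) * Complex.exp (-(θ * Complex.I)) + (r * Complex.exp (θ * Complex.I)
          - ν * (θ * Complex.I)) = ((2 * r * Real.sin θ - ν * θ : ℝ) : ℂ) * Complex.I := by
        rw [← neg_mul, Complex.exp_mul_I, Complex.exp_mul_I, Complex.cos_neg, Complex.sin_neg]
        push_cast; ring
      rw [e, Complex.exp_ofReal_mul_I_re]

theorem hasSum_hankelRay {r : ℝ} (hr : 0 < r) (ν : ℝ) :
    HasSum (fun k : ℕ => r ^ k / k.factorial * hankelRay r (ν + k))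
      (∫ u in Ioi (0 : ℝ), Real.exp (-(2 * r * Real.sinh u) - ν * u)) := by
  have h := hasSum_integral_of_dominated_convergence (μ := volume.restrict (Ioi (0 : ℝ)))
    (F := fun (k : ℕ) u => r ^ k / k.factorial * Real.exp (-(r * Real.exp u) - (ν + k) * u))
    (f := fun u => Real.exp (-(2 * r * Real.sinh u) - ν * u))
    (fun k u => r ^ k / k.factorial * Real.exp (-(r * Real.exp u) - ν * u))
    (fun k => Continuous.aestronglyMeasurable (by fun_prop))
    (fun k => (ae_restrict_iff' measurableSet_Ioi).mpr (Eventually.of_forall fun u hu => ?_))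
    (Eventually.of_forall fun u => (Real.summable_pow_div_factorial r).mul_right _)
    (by
      simp_rw [tsum_mul_right]
      exact (integrableOn_hankelRay hr ν).const_mul _)
    (Eventually.of_forall fun u => ?_)
  · exact hasSum_of_eq h (fun k => by simp only [integral_const_mul, hankelRay]) rfl
  · rw [Real.norm_of_nonneg (by positivity)]
    refine mul_le_mul_of_nonneg_left (Real.exp_le_exp.mpr ?_) (by positivity)
    have : 0 ≤ (k : ℝ) * u := mul_nonneg k.cast_nonneg (le_of_lt hu)
    linarith
  · have hs := (NormedSpace.expSeries_div_hasSum_exp (r * Real.exp (-u))).mul_right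
        (Real.exp (-(r * Real.exp u) - ν * u))
    rw [← Real.exp_eq_exp_ℝ, ← Real.exp_add] at hs
    refine hasSum_of_eq hs (fun k => ?_) ?_
    · rw [mul_pow, ← Real.exp_nat_mul, mul_div_right_comm, mul_assoc, ← Real.exp_add]
      congr 2; ring
    · rw [Real.sinh_eq]; congr 1; ring

/-- The exponential part of Schläfli's integrals for the Bessel functions. -/
noncomputable def schlafliExp (ν x : ℝ) : ℝ :=
  ∫ u in Ioi (0 : ℝ), Real.exp (-(x * Real.sinh u) + ν * u)

theorem sin_pi_mul_add_nat (ν : ℝ) (k : ℕ) :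
    Real.sin (Real.pi * (ν + k)) = (-1) ^ k * Real.sin (Real.pi * ν) := by
  rw [mul_add, mul_comm Real.pi (k : ℝ), Real.sin_add_nat_mul_pi]

/-- Schläfli's integral for the Bessel function of the first kind. -/
theorem besselJ_eq_schlafli (ν : ℝ) {x : ℝ} (hx : 0 < x) :
    besselJ ν x = ((∫ θ in (0 : ℝ)..Real.pi, Real.cos (x * Real.sin θ - ν * θ)) -
      Real.sin (Real.pi * ν) * schlafliExp (-ν) x) / Real.pi := by
  have hr : 0 < x / 2 := half_pos hx
  -- The free radius in Hankel's formula is taken to be `x / 2`, so that the `k`-th term of the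
  -- Bessel series becomes the formula at `z = ν + k`. The sign `(-1)^k` of `sin (π (ν + k))`
  -- cancels the alternating sign of the ray series.
  have h := ((hasSum_hankelCircle (x / 2) ν).sub
    ((hasSum_hankelRay hr ν).mul_left (Real.sin (Real.pi * ν)))).div_const Real.pi
  have e : ∀ k : ℕ, ((-(x / 2)) ^ k / k.factorial * hankelCircle (x / 2) (ν + k) -
      Real.sin (Real.pi * ν) * ((x / 2) ^ k / k.factorial * hankelRay (x / 2) (ν + k))) / Real.pi =
      (-1 : ℝ) ^ k / ((k.factorial : ℝ) * Real.Gamma ((k : ℝ) + ν + 1)) *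
        (x / 2) ^ (2 * (k : ℝ) + ν) := fun k => by
    have h1 := hankelCircle_sub_eq hr (ν + k)
    rw [sin_pi_mul_add_nat] at h1
    have h2 : (x / 2) ^ (2 * (k : ℝ) + ν) = (x / 2) ^ k * (x / 2) ^ (ν + k) := by
      rw [← Real.rpow_natCast, ← Real.rpow_add hr]; congr 1; ring
    have h3 : (-(x / 2)) ^ k = (-1) ^ k * (x / 2) ^ k := neg_pow _ _
    have h4 : ((-1 : ℝ) ^ k) * (-1) ^ k = 1 := by rw [← mul_pow]; norm_num
    have h5 : ((-(x / 2)) ^ k / k.factorial * hankelCircle (x / 2) (ν + k) -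
      Real.sin (Real.pi * ν) * ((x / 2) ^ k / k.factorial * hankelRay (x / 2) (ν + k))) =
      (-1) ^ k * (x / 2) ^ k / k.factorial * (hankelCircle (x / 2) (ν + k) -
        (-1) ^ k * Real.sin (Real.pi * ν) * hankelRay (x / 2) (ν + k)) := by
      rw [h3]
      linear_combination (x / 2) ^ k / k.factorial *
        (Real.sin (Real.pi * ν) * hankelRay (x / 2) (ν + k)) * h4
    rw [h5, h1, h2, add_comm ν k, mul_left_comm, mul_div_cancel_left₀ _ Real.pi_ne_zero,
      div_mul_eq_div_div]
    ring
  rw [besselJ, (hasSum_of_eq h (fun k => (e k).symm) rfl).tsum_eq, schlafliExp]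
  simp only [mul_div_cancel₀ x two_ne_zero, neg_mul, sub_eq_add_neg]

theorem exp_neg_mul_sinh_add_le {x : ℝ} (hx : 0 < x) {ν b : ℝ} (hb : |ν| ≤ b) {u : ℝ}
    (hu : 0 ≤ u) :
    Real.exp (-(x * Real.sinh u) + ν * u) ≤ Real.exp (-(x / 4) * u ^ 2 + b * |u|) := by
  refine Real.exp_le_exp.mpr ?_
  have h1 := Real.quadratic_le_exp_of_nonneg hu
  have h2 : Real.exp (-u) ≤ 1 := Real.exp_le_one_iff.mpr (by linarith)
  have h3 : u ^ 2 / 4 ≤ Real.sinh u := by rw [Real.sinh_eq]; linarith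
  have h4 : ν * u ≤ b * |u| := by
    rw [abs_of_nonneg hu]
    exact mul_le_mul_of_nonneg_right ((le_abs_self _).trans hb) hu
  nlinarith

theorem integrableOn_schlafliExp (ν : ℝ) {x : ℝ} (hx : 0 < x) :
    IntegrableOn (fun u : ℝ => Real.exp (-(x * Real.sinh u) + ν * u)) (Ioi 0) := by
  refine (integrable_exp_neg_sq_add_abs (c := x / 4) (by positivity) |ν|).integrableOn.mono'
    (by fun_prop) ?_
  refine (ae_restrict_iff' measurableSet_Ioi).mpr (Eventually.of_forall fun u hu => ?_)
  rw [Real.norm_of_nonneg (Real.exp_pos _).le]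
  exact exp_neg_mul_sinh_add_le hx le_rfl (le_of_lt hu)

theorem continuous_schlafliExp {x : ℝ} (hx : 0 < x) : Continuous fun ν => schlafliExp ν x := by
  refine continuous_iff_continuousAt.mpr fun ν₀ => ?_
  refine continuousAt_of_dominated
    (bound := fun u => Real.exp (-(x / 4) * u ^ 2 + (|ν₀| + 1) * |u|))
    (Eventually.of_forall fun ν => Continuous.aestronglyMeasurable (by fun_prop)) ?_
    (integrable_exp_neg_sq_add_abs (by positivity) _).integrableOn
    (Eventually.of_forall fun u => by fun_prop)
  filter_upwards [Metric.ball_mem_nhds ν₀ one_pos] with ν hν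
  refine (ae_restrict_iff' measurableSet_Ioi).mpr (Eventually.of_forall fun u hu => ?_)
  rw [Real.norm_of_nonneg (Real.exp_pos _).le]
  refine exp_neg_mul_sinh_add_le hx ?_ (le_of_lt hu)
  have h1 : |ν - ν₀| < 1 := by simpa [Real.dist_eq] using hν
  have h2 := abs_sub_abs_le_abs_sub ν ν₀
  linarith

/-- The reflection `θ ↦ π - θ`. It makes `sin (π ν)` factor out of the numerator of the quotient
defining `Y`, leaving an expression that is continuous in `ν` also at the integers. -/
theorem integral_cos_neg_order (ν x : ℝ) :
    ∫ θ in (0 : ℝ)..Real.pi, Real.cos (x * Real.sin θ - -ν * θ) =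
      Real.cos (Real.pi * ν) * (∫ θ in (0 : ℝ)..Real.pi, Real.cos (x * Real.sin θ - ν * θ)) -
      Real.sin (Real.pi * ν) * ∫ θ in (0 : ℝ)..Real.pi, Real.sin (x * Real.sin θ - ν * θ) := by
  have h := intervalIntegral.integral_comp_sub_left (a := 0) (b := Real.pi)
    (fun θ => Real.cos (x * Real.sin θ - -ν * θ)) Real.pi
  rw [sub_self, sub_zero] at h
  rw [← h, ← intervalIntegral.integral_const_mul, ← intervalIntegral.integral_const_mul,
    ← intervalIntegral.integral_sub (Continuous.intervalIntegrable (by fun_prop) _ _)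
      (Continuous.intervalIntegrable (by fun_prop) _ _)]
  congr 1
  ext θ
  rw [Real.sin_pi_sub, ← Real.cos_add]
  congr 1; ring

theorem besselYQuot_eq_schlafli {ν x : ℝ} (hx : 0 < x) (hν : Real.sin (Real.pi * ν) ≠ 0) :
    besselYQuot ν x = ((∫ θ in (0 : ℝ)..Real.pi, Real.sin (x * Real.sin θ - ν * θ)) -
      Real.cos (Real.pi * ν) * schlafliExp (-ν) x - schlafliExp ν x) / Real.pi := by
  rw [besselYQuot, besselJ_eq_schlafli ν hx, besselJ_eq_schlafli (-ν) hx, integral_cos_neg_order,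
    mul_comm ν Real.pi, neg_neg, mul_neg, Real.sin_neg]
  generalize Real.sin (Real.pi * ν) = s at *
  field_simp
  ring

theorem real_sin_pi_mul_ne_zero {ν : ℝ} (h : ¬∃ n : ℤ, (n : ℝ) = ν) : Real.sin (Real.pi * ν) ≠ 0 := by
  intro h0
  obtain ⟨n, hn⟩ := Real.sin_eq_zero_iff.mp h0
  refine h ⟨n, ?_⟩
  rw [mul_comm] at hn
  exact mul_left_cancel₀ Real.pi_ne_zero hn

/-- Schläfli's integral for the Bessel function of the second kind. -/
theorem besselY_eq_schlafli (ν : ℝ) {x : ℝ} (hx : 0 < x) :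
    besselY ν x = ((∫ θ in (0 : ℝ)..Real.pi, Real.sin (x * Real.sin θ - ν * θ)) -
      Real.cos (Real.pi * ν) * schlafliExp (-ν) x - schlafliExp ν x) / Real.pi := by
  rw [besselY]
  split_ifs with h
  · obtain ⟨n, rfl⟩ := h
    refine Tendsto.limUnder_eq ?_
    have hc : Continuous fun μ : ℝ =>
        ((∫ θ in (0 : ℝ)..Real.pi, Real.sin (x * Real.sin θ - μ * θ)) -
          Real.cos (Real.pi * μ) * schlafliExp (-μ) x - schlafliExp μ x) / Real.pi := by
      have h1 := continuous_schlafliExp hx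
      have h2 : Continuous fun μ : ℝ => schlafliExp (-μ) x := h1.comp continuous_neg
      have h3 : Continuous fun μ : ℝ =>
          ∫ θ in (0 : ℝ)..Real.pi, Real.sin (x * Real.sin θ - μ * θ) :=
        intervalIntegral.continuous_parametric_intervalIntegral_of_continuous' (by fun_prop) _ _
      fun_prop
    refine ((hc.tendsto (n : ℝ)).mono_left nhdsWithin_le_nhds).congr' ?_
    have hev : ∀ᶠ μ : ℝ in 𝓝[≠] (n : ℝ), μ ∈ Ioo ((n : ℝ) - 1) (n + 1) :=
      nhdsWithin_le_nhds (Ioo_mem_nhds (by linarith) (by linarith))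
    filter_upwards [hev, self_mem_nhdsWithin] with μ hμ hne
    refine (besselYQuot_eq_schlafli hx (real_sin_pi_mul_ne_zero ?_)).symm
    rintro ⟨m, rfl⟩
    have h1 : n - 1 < m := by exact_mod_cast hμ.1
    have h2 : m < n + 1 := by exact_mod_cast hμ.2
    have : m = n := by omega
    exact hne (by rw [this]; rfl)
  · exact besselYQuot_eq_schlafli hx (real_sin_pi_mul_ne_zero h)

/-! ### Contour integrals of `exp (x sinh w - ν w)` -/

/-- The integrand of the contour integrals for the Hankel function. -/
noncomputable def hankelKernel (ν x : ℝ) (w : ℂ) : ℂ := Complex.exp (x * Complex.sinh w - ν * w)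

/-- With an entire primitive, deforming a contour amounts to comparing the limits of the primitive
along the ends of two paths. -/
theorem exists_primitive_hankelKernel (ν x : ℝ) :
    ∃ F : ℂ → ℂ, ∀ w, HasDerivAt F (hankelKernel ν x w) w := by
  obtain ⟨F, hF⟩ := Differentiable.isExactOn_univ
    (f := hankelKernel ν x) (by unfold hankelKernel; fun_prop)
  exact ⟨F, fun w => hF w (mem_univ w)⟩

theorem norm_hankelKernel (ν x a b : ℝ) :
    ‖hankelKernel ν x (a + b * Complex.I)‖ = Real.exp (x * Real.sinh a * Real.cos b - ν * a) := by
  rw [hankelKernel, Complex.norm_exp, Complex.sinh_add, Complex.sinh_mul_I, Complex.cosh_mul_I]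
  congr 1
  simp [← Complex.ofReal_sinh, ← Complex.ofReal_cosh, ← Complex.ofReal_cos, ← Complex.ofReal_sin]
  ring

theorem tendsto_exp_neg_sq_add_abs {c : ℝ} (hc : 0 < c) (b : ℝ) :
    Tendsto (fun u : ℝ => Real.exp (-c * u ^ 2 + b * |u|)) atTop (𝓝 0) := by
  refine Real.tendsto_exp_atBot.comp ?_
  have h : Tendsto (fun u : ℝ => u * (-c * u + b)) atTop atBot :=
    tendsto_id.atTop_mul_atBot₀
      (tendsto_atBot_add_const_right _ _ (tendsto_id.const_mul_atTop_of_neg (neg_lt_zero.mpr hc)))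
  refine h.congr' ?_
  filter_upwards [eventually_ge_atTop 0] with u hu
  rw [abs_of_nonneg hu]; ring

theorem integrableOn_schlafliExp_complex (ν : ℝ) {x : ℝ} (hx : 0 < x) :
    IntegrableOn (fun u : ℝ => ((Real.exp (-(x * Real.sinh u) + ν * u) : ℝ) : ℂ)) (Ioi 0) :=
  (integrableOn_schlafliExp ν hx).ofReal

section Primitive

variable {ν x : ℝ} {F : ℂ → ℂ}

theorem tendsto_primitive_neg (hx : 0 < x) (hF : ∀ w, HasDerivAt F (hankelKernel ν x w) w) :
    Tendsto (fun R : ℝ => F (-R)) atTop (𝓝 (F 0 - schlafliExp ν x)) := by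
  have hd : ∀ t : ℝ, HasDerivAt (fun t : ℝ => F (-t))
      (-((Real.exp (-(x * Real.sinh t) + ν * t) : ℝ) : ℂ)) t := fun t => by
    have h1 : HasDerivAt (fun t : ℝ => -(t : ℂ)) (-1) t := (Complex.ofRealCLM.hasDerivAt).neg
    refine ((hF _).comp t h1).congr_deriv ?_
    rw [hankelKernel, Complex.sinh_neg]
    push_cast
    rw [mul_neg_one]; congr 2; ring
  have hint := integrableOn_schlafliExp_complex ν hx
  have h := intervalIntegral_tendsto_integral_Ioi 0 hint.neg tendsto_id
  have e : ∀ R : ℝ, ∫ t in (0 : ℝ)..R, -((Real.exp (-(x * Real.sinh t) + ν * t) : ℝ) : ℂ) =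
      F (-R) - F 0 := fun R => by
    rw [intervalIntegral.integral_eq_sub_of_hasDerivAt (fun t _ => hd t)
      (Continuous.intervalIntegrable (by fun_prop) _ _)]
    simp
  have h2 := (h.congr e).add_const (F 0)
  simp only [sub_add_cancel] at h2
  convert h2 using 2
  simp only [Pi.neg_apply]
  rw [integral_neg, integral_complex_ofReal, ← schlafliExp]
  ring

theorem primitive_pi_mul_I (hF : ∀ w, HasDerivAt F (hankelKernel ν x w) w) :
    F (Real.pi * Complex.I) = F 0 -
      (∫ θ in (0 : ℝ)..Real.pi, Real.sin (x * Real.sin θ - ν * θ) : ℝ) +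
      (∫ θ in (0 : ℝ)..Real.pi, Real.cos (x * Real.sin θ - ν * θ) : ℝ) * Complex.I := by
  have hd : ∀ θ : ℝ, HasDerivAt (fun θ : ℝ => F (θ * Complex.I))
      (((-Real.sin (x * Real.sin θ - ν * θ) : ℝ) : ℂ) +
        ((Real.cos (x * Real.sin θ - ν * θ) : ℝ) : ℂ) * Complex.I) θ := fun θ => by
    have h1 : HasDerivAt (fun θ : ℝ => (θ : ℂ) * Complex.I) (1 * Complex.I) θ :=
      (Complex.ofRealCLM.hasDerivAt).mul_const _
    refine ((hF _).comp θ h1).congr_deriv ?_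
    have e : x * Complex.sinh (θ * Complex.I) - ν * (θ * Complex.I) =
        ((x * Real.sin θ - ν * θ : ℝ) : ℂ) * Complex.I := by
      rw [Complex.sinh_mul_I]; push_cast; ring
    rw [hankelKernel, e, Complex.exp_mul_I]
    push_cast
    linear_combination Complex.sin (x * Complex.sin θ - ν * θ) * Complex.I_mul_I
  have h := intervalIntegral.integral_eq_sub_of_hasDerivAt (fun θ (_ : θ ∈ uIcc 0 Real.pi) => hd θ)
    (Continuous.intervalIntegrable (by fun_prop) _ _)
  rw [intervalIntegral.integral_add (Continuous.intervalIntegrable (by fun_prop) _ _)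
    (Continuous.intervalIntegrable (by fun_prop) _ _), intervalIntegral.integral_mul_const,
    intervalIntegral.integral_ofReal, intervalIntegral.integral_ofReal,
    intervalIntegral.integral_neg] at h
  simp only [Complex.ofReal_zero, zero_mul] at h
  push_cast at h ⊢
  linear_combination -h

/-- Going up from `0` to `π i` and then along the line of height `π` produces exactly Schläfli's
integrals. Relative to the limit at `-∞`, the increment of `F` is `π i (J + i Y)`. -/
theorem tendsto_primitive_add_pi_mul_I (hx : 0 < x)
    (hF : ∀ w, HasDerivAt F (hankelKernel ν x w) w) :
    Tendsto (fun R : ℝ => F (R + Real.pi * Complex.I)) atTop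
      (𝓝 (F 0 - schlafliExp ν x - (Real.pi * besselY ν x : ℝ) +
        (Real.pi * besselJ ν x : ℝ) * Complex.I)) := by
  have hd : ∀ t : ℝ, HasDerivAt (fun t : ℝ => F (t + Real.pi * Complex.I))
      (((Real.cos (Real.pi * ν) : ℂ) - Real.sin (Real.pi * ν) * Complex.I) *
        ((Real.exp (-(x * Real.sinh t) + -ν * t) : ℝ) : ℂ)) t := fun t => by
    have h1 : HasDerivAt (fun t : ℝ => (t : ℂ) + Real.pi * Complex.I) 1 t :=
      (Complex.ofRealCLM.hasDerivAt).add_const _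
    refine ((hF _).comp t h1).congr_deriv ?_
    have e : x * Complex.sinh (t + Real.pi * Complex.I) - ν * (t + Real.pi * Complex.I) =
        ((-(x * Real.sinh t) + -ν * t : ℝ) : ℂ) + (-(Real.pi * ν) : ℂ) * Complex.I := by
      rw [Complex.sinh_add, Complex.sinh_mul_I, Complex.cosh_mul_I, Complex.cos_pi, Complex.sin_pi]
      push_cast; ring
    rw [hankelKernel, e, Complex.exp_add, Complex.exp_mul_I, Complex.cos_neg, Complex.sin_neg]
    push_cast
    ring
  have hint := (integrableOn_schlafliExp_complex (-ν) hx).const_mul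
    ((Real.cos (Real.pi * ν) : ℂ) - Real.sin (Real.pi * ν) * Complex.I)
  have h := intervalIntegral_tendsto_integral_Ioi 0 hint tendsto_id
  have e : ∀ R : ℝ, ∫ t in (0 : ℝ)..R,
      ((Real.cos (Real.pi * ν) : ℂ) - Real.sin (Real.pi * ν) * Complex.I) *
        ((Real.exp (-(x * Real.sinh t) + -ν * t) : ℝ) : ℂ) =
      F (R + Real.pi * Complex.I) - F (Real.pi * Complex.I) := fun R => by
    rw [intervalIntegral.integral_eq_sub_of_hasDerivAt (fun t _ => hd t)
      (Continuous.intervalIntegrable (by fun_prop) _ _)]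
    simp
  have h2 := (h.congr e).add_const (F (Real.pi * Complex.I))
  simp only [sub_add_cancel] at h2
  convert h2 using 2
  rw [integral_const_mul, integral_complex_ofReal, primitive_pi_mul_I hF, besselY_eq_schlafli ν hx,
    besselJ_eq_schlafli ν hx, mul_div_cancel₀ _ Real.pi_ne_zero, mul_div_cancel₀ _ Real.pi_ne_zero,
    ← schlafliExp]
  push_cast
  ring

theorem norm_primitive_sub_vertical_le (hF : ∀ w, HasDerivAt F (hankelKernel ν x w) w)
    {a b₁ b₂ M : ℝ} (hb : b₁ ≤ b₂)
    (hM : ∀ b ∈ Icc b₁ b₂, x * Real.sinh a * Real.cos b - ν * a ≤ M) :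
    ‖F (a + b₂ * Complex.I) - F (a + b₁ * Complex.I)‖ ≤ Real.exp M * (b₂ - b₁) := by
  have hd : ∀ b ∈ Icc b₁ b₂, HasDerivWithinAt (fun b : ℝ => F (a + b * Complex.I))
      (hankelKernel ν x (a + b * Complex.I) * (1 * Complex.I)) (Icc b₁ b₂) b := fun b _ => by
    have h1 : HasDerivAt (fun b : ℝ => (a : ℂ) + b * Complex.I) (1 * Complex.I) b :=
      ((Complex.ofRealCLM.hasDerivAt).mul_const _).const_add _
    exact ((hF _).comp b h1).hasDerivWithinAt
  refine norm_image_sub_le_of_norm_deriv_le_segment' hd (fun b hb' => ?_) b₂ ⟨hb, le_rfl⟩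
  rw [norm_mul, one_mul, Complex.norm_I, mul_one, norm_hankelKernel]
  exact Real.exp_le_exp.mpr (hM b ⟨hb'.1, hb'.2.le⟩)

end Primitive

/-! ### Steepest descent path through `π i / 2` and moments of the kernel -/

/-- The decay rate of the Hankel kernel along its path of steepest descent. -/
noncomputable def descentRate (a : ℝ) : ℝ := Real.sinh a ^ 2 / Real.cosh a

/-- The path of steepest descent through `π i / 2` for `sinh`. -/
noncomputable def descentPath (a : ℝ) : ℂ :=
  a + ((Real.pi / 2 + Real.arctan (Real.sinh a) : ℝ) : ℂ) * Complex.I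

/-- The velocity of `descentPath`. -/
noncomputable def descentVel (a : ℝ) : ℂ := 1 + ((1 / Real.cosh a : ℝ) : ℂ) * Complex.I

theorem sqrt_one_add_sinh_sq (a : ℝ) : √(1 + Real.sinh a ^ 2) = Real.cosh a := by
  rw [add_comm, ← Real.cosh_sq, Real.sqrt_sq (Real.cosh_pos a).le]

theorem cos_pi_div_two_add_arctan_sinh (a : ℝ) :
    Real.cos (Real.pi / 2 + Real.arctan (Real.sinh a)) = -(Real.sinh a / Real.cosh a) := by
  rw [add_comm, Real.cos_add_pi_div_two, Real.sin_arctan, sqrt_one_add_sinh_sq]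

theorem sin_pi_div_two_add_arctan_sinh (a : ℝ) :
    Real.sin (Real.pi / 2 + Real.arctan (Real.sinh a)) = 1 / Real.cosh a := by
  rw [add_comm, Real.sin_add_pi_div_two, Real.cos_arctan, sqrt_one_add_sinh_sq]

theorem sinh_descentPath (a : ℝ) :
    Complex.sinh (descentPath a) = -(descentRate a : ℂ) + Complex.I := by
  rw [descentPath, Complex.sinh_add, Complex.sinh_mul_I, Complex.cosh_mul_I,
    ← Complex.ofReal_sin, ← Complex.ofReal_cos, ← Complex.ofReal_sinh, ← Complex.ofReal_cosh,
    cos_pi_div_two_add_arctan_sinh, sin_pi_div_two_add_arctan_sinh, descentRate]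
  have h : (Real.cosh a : ℂ) ≠ 0 := Complex.ofReal_ne_zero.mpr (Real.cosh_pos a).ne'
  push_cast at h ⊢
  field_simp

theorem hasDerivAt_descentPath (a : ℝ) : HasDerivAt descentPath (descentVel a) a := by
  have h1 := (((Real.hasDerivAt_sinh a).arctan).const_add (Real.pi / 2)).ofReal_comp
  have h2 := (Complex.ofRealCLM.hasDerivAt (x := a)).add (h1.mul_const Complex.I)
  refine h2.congr_deriv ?_
  rw [descentVel]
  have h4 : 1 / (1 + Real.sinh a ^ 2) * Real.cosh a = 1 / Real.cosh a := by
    rw [add_comm, ← Real.cosh_sq]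
    field_simp
  rw [h4]; rfl

theorem continuous_descentPath : Continuous descentPath :=
  continuous_iff_continuousAt.mpr fun a => (hasDerivAt_descentPath a).continuousAt

theorem continuous_descentVel : Continuous descentVel := by
  have : Continuous fun a => 1 / Real.cosh a :=
    continuous_const.div Real.continuous_cosh fun a => (Real.cosh_pos a).ne'
  unfold descentVel
  fun_prop

theorem continuous_descentRate : Continuous descentRate :=
  (Real.continuous_sinh.pow 2).div Real.continuous_cosh fun a => (Real.cosh_pos a).ne'

theorem norm_descentVel_le (a : ℝ) : ‖descentVel a‖ ≤ 2 := by
  refine (norm_add_le _ _).trans ?_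
  rw [norm_mul, Complex.norm_I, mul_one, norm_one, Complex.norm_real, Real.norm_eq_abs,
    abs_of_pos (by positivity [Real.cosh_pos a])]
  have : 1 / Real.cosh a ≤ 1 := by
    rw [div_le_one (Real.cosh_pos a)]; exact Real.one_le_cosh a
  linarith

theorem descentRate_nonneg (a : ℝ) : 0 ≤ descentRate a :=
  div_nonneg (sq_nonneg _) (Real.cosh_pos a).le

/-- From `cosh a = 1 + 2 sinh² (a/2) ≥ 1 + a²/2` and `sinh² a = cosh² a - 1`. This Gaussian decay
dominates every integrand along the path. -/
theorem half_sq_le_descentRate (a : ℝ) : a ^ 2 / 2 ≤ descentRate a := by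
  rw [descentRate, le_div_iff₀ (Real.cosh_pos a)]
  have h1 : Real.cosh a = 1 + 2 * Real.sinh (a / 2) ^ 2 := by
    have := Real.cosh_two_mul (a / 2)
    rw [mul_div_cancel₀ a two_ne_zero, Real.cosh_sq] at this
    linarith
  have h2 : (a / 2) ^ 2 ≤ Real.sinh (a / 2) ^ 2 := by
    rw [← sq_abs, ← sq_abs (Real.sinh _), Real.abs_sinh]
    exact pow_le_pow_left₀ (abs_nonneg _) (Real.self_le_sinh_iff.mpr (abs_nonneg _)) 2
  have h3 := Real.cosh_sq a
  have h4 := Real.one_le_cosh a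
  nlinarith

theorem norm_hankelKernel_descentPath (ν x a : ℝ) :
    ‖hankelKernel ν x (descentPath a)‖ = Real.exp (-(x * descentRate a) - ν * a) := by
  rw [descentPath, norm_hankelKernel, cos_pi_div_two_add_arctan_sinh, descentRate]
  congr 1; ring

theorem hasDerivAt_comp_descentPath {F : ℂ → ℂ} {F' : ℂ} {a : ℝ}
    (hF : HasDerivAt F F' (descentPath a)) :
    HasDerivAt (fun a => F (descentPath a)) (F' * descentVel a) a :=
  hF.comp a (hasDerivAt_descentPath a)

theorem one_add_pow_mul_exp_le (n : ℕ) {c s : ℝ} (hc : 0 < c) (hs : 0 ≤ s) :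
    (1 + s) ^ n * Real.exp (-(c * s)) ≤
      n.factorial * (2 / c) ^ n * Real.exp (c / 2) * Real.exp (-(c / 2 * s)) := by
  have h := Real.pow_div_factorial_le_exp (c / 2 * (1 + s)) (by positivity) n
  rw [div_le_iff₀ (by positivity), mul_pow] at h
  have e : Real.exp (c / 2 * (1 + s)) * Real.exp (-(c * s)) =
      Real.exp (c / 2) * Real.exp (-(c / 2 * s)) := by
    rw [← Real.exp_add, ← Real.exp_add]; congr 1; ring
  have e2 : (2 / c) ^ n * (c / 2) ^ n = 1 := by
    rw [← mul_pow]
    field_simp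
    simp
  calc (1 + s) ^ n * Real.exp (-(c * s))
      = (2 / c) ^ n * ((c / 2) ^ n * (1 + s) ^ n) * Real.exp (-(c * s)) := by
        rw [← mul_assoc, e2, one_mul]
    _ ≤ (2 / c) ^ n * (Real.exp (c / 2 * (1 + s)) * n.factorial) * Real.exp (-(c * s)) := by
        gcongr
    _ = n.factorial * (2 / c) ^ n * (Real.exp (c / 2 * (1 + s)) * Real.exp (-(c * s))) := by ring
    _ = _ := by rw [e]; ring

theorem one_add_descentRate_pow_mul_norm_le (n : ℕ) (ν : ℝ) {c x : ℝ} (hc : 0 < c) (hx : c ≤ x)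
    (a : ℝ) :
    (1 + descentRate a) ^ n * ‖hankelKernel ν x (descentPath a)‖ ≤
      n.factorial * (2 / c) ^ n * Real.exp (c / 2) * Real.exp (-(c / 4) * a ^ 2 + |ν| * |a|) := by
  have hs := descentRate_nonneg a
  have h1 : Real.exp (-(x * descentRate a) - ν * a) ≤
      Real.exp (-(c * descentRate a)) * Real.exp (|ν| * |a|) := by
    rw [← Real.exp_add]
    refine Real.exp_le_exp.mpr ?_
    have : -ν * a ≤ |ν| * |a| := by
      rw [← abs_mul]; exact (le_abs_self _).trans (by rw [neg_mul, abs_neg])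
    nlinarith
  have h2 : Real.exp (-(c / 2 * descentRate a)) * Real.exp (|ν| * |a|) ≤
      Real.exp (-(c / 4) * a ^ 2 + |ν| * |a|) := by
    rw [← Real.exp_add]
    refine Real.exp_le_exp.mpr ?_
    have := half_sq_le_descentRate a
    nlinarith
  rw [norm_hankelKernel_descentPath]
  calc (1 + descentRate a) ^ n * Real.exp (-(x * descentRate a) - ν * a)
      ≤ (1 + descentRate a) ^ n * (Real.exp (-(c * descentRate a)) * Real.exp (|ν| * |a|)) := by
        gcongr
    _ = ((1 + descentRate a) ^ n * Real.exp (-(c * descentRate a))) * Real.exp (|ν| * |a|) := by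
        ring
    _ ≤ (n.factorial * (2 / c) ^ n * Real.exp (c / 2) * Real.exp (-(c / 2 * descentRate a))) *
        Real.exp (|ν| * |a|) := by
        exact mul_le_mul_of_nonneg_right (one_add_pow_mul_exp_le n hc hs) (Real.exp_pos _).le
    _ = n.factorial * (2 / c) ^ n * Real.exp (c / 2) *
        (Real.exp (-(c / 2 * descentRate a)) * Real.exp (|ν| * |a|)) := by ring
    _ ≤ _ := by gcongr

theorem norm_sinh_descentPath_le (a : ℝ) : ‖Complex.sinh (descentPath a)‖ ≤ 1 + descentRate a := by
  rw [sinh_descentPath]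
  refine (norm_add_le _ _).trans ?_
  rw [norm_neg, Complex.norm_I, Complex.norm_real, Real.norm_of_nonneg (descentRate_nonneg a),
    add_comm]

/-- The integrand of the moments of the Hankel kernel along the path of steepest descent. -/
noncomputable def hankelIntegrand (n : ℕ) (ν x a : ℝ) : ℂ :=
  Complex.sinh (descentPath a) ^ n * (hankelKernel ν x (descentPath a) * descentVel a)

theorem continuous_hankelKernel (ν x : ℝ) : Continuous (hankelKernel ν x) := by
  unfold hankelKernel; fun_prop

theorem continuous_hankelIntegrand (n : ℕ) (ν x : ℝ) : Continuous (hankelIntegrand n ν x) :=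
  ((Complex.continuous_sinh.comp continuous_descentPath).pow n).mul
    (((continuous_hankelKernel ν x).comp continuous_descentPath).mul continuous_descentVel)

theorem norm_hankelIntegrand_le (n : ℕ) (ν : ℝ) {c x : ℝ} (hc : 0 < c) (hx : c ≤ x) (a : ℝ) :
    ‖hankelIntegrand n ν x a‖ ≤ 2 * (n.factorial * (2 / c) ^ n * Real.exp (c / 2)) *
      Real.exp (-(c / 4) * a ^ 2 + |ν| * |a|) := by
  rw [hankelIntegrand, norm_mul, norm_mul, norm_pow]
  have h0 := descentRate_nonneg a
  have h1 := one_add_descentRate_pow_mul_norm_le n ν hc hx a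
  have h2 := norm_descentVel_le a
  have h3 : ‖Complex.sinh (descentPath a)‖ ^ n ≤ (1 + descentRate a) ^ n :=
    pow_le_pow_left₀ (norm_nonneg _) (norm_sinh_descentPath_le a) n
  calc _ ≤ (1 + descentRate a) ^ n * (‖hankelKernel ν x (descentPath a)‖ * 2) := by gcongr
    _ = 2 * ((1 + descentRate a) ^ n * ‖hankelKernel ν x (descentPath a)‖) := by ring
    _ ≤ 2 * _ := mul_le_mul_of_nonneg_left h1 zero_le_two
    _ = _ := by ring

theorem integrable_hankelIntegrand (n : ℕ) (ν : ℝ) {x : ℝ} (hx : 0 < x) :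
    Integrable (hankelIntegrand n ν x) :=
  ((integrable_exp_neg_sq_add_abs (c := x / 4) (by positivity) |ν|).const_mul _).mono'
    (continuous_hankelIntegrand n ν x).aestronglyMeasurable
    (Eventually.of_forall (norm_hankelIntegrand_le n ν hx le_rfl))

/-- The moments of the Hankel kernel along the path of steepest descent. -/
noncomputable def hankelMoment (n : ℕ) (ν x : ℝ) : ℂ := ∫ a, hankelIntegrand n ν x a

/-- Differentiating the kernel in `x` brings down one factor `sinh w`, so the moments are the
successive derivatives of the zeroth one. -/
theorem hasDerivAt_hankelMoment (n : ℕ) (ν : ℝ) {x : ℝ} (hx : 0 < x) :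
    HasDerivAt (hankelMoment n ν) (hankelMoment (n + 1) ν x) x := by
  refine (hasDerivAt_integral_of_dominated_loc_of_deriv_le
    (Ioi_mem_nhds (half_lt_self hx)) (Eventually.of_forall fun y =>
      (continuous_hankelIntegrand n ν y).aestronglyMeasurable)
    (integrable_hankelIntegrand n ν hx)
    (continuous_hankelIntegrand (n + 1) ν x).aestronglyMeasurable
    (Eventually.of_forall fun a y hy =>
      norm_hankelIntegrand_le (n + 1) ν (half_pos hx) (le_of_lt hy) a)
    ((integrable_exp_neg_sq_add_abs (c := x / 2 / 4) (by positivity) |ν|).const_mul _)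
    (Eventually.of_forall fun a y _ => ?_)).2
  have h1 : HasDerivAt (fun y : ℝ => (y : ℂ) * Complex.sinh (descentPath a) - ν * descentPath a)
      (1 * Complex.sinh (descentPath a)) y :=
    ((Complex.ofRealCLM.hasDerivAt).mul_const _).sub_const _
  refine ((h1.cexp.mul_const (descentVel a)).const_mul
    (Complex.sinh (descentPath a) ^ n)).congr_deriv ?_
  rw [hankelIntegrand, hankelKernel, pow_succ]; ring

theorem tendsto_exp_quadratic_zero {c : ℝ} (hc : 0 < c) (C b : ℝ) :
    Tendsto (fun u : ℝ => C * Real.exp (-c * u ^ 2 + b * |u|)) atTop (𝓝 0) ∧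
    Tendsto (fun u : ℝ => C * Real.exp (-c * u ^ 2 + b * |u|)) atBot (𝓝 0) := by
  have h := (tendsto_exp_neg_sq_add_abs hc b).const_mul C
  rw [mul_zero] at h
  exact ⟨h, (h.comp tendsto_neg_atBot_atTop).congr fun u => by simp⟩

theorem norm_cosh_descentPath_le (a : ℝ) :
    ‖Complex.cosh (descentPath a)‖ ≤ 2 * (1 + descentRate a) := by
  have h0 := descentRate_nonneg a
  refine abs_le_of_sq_le_sq' ?_ (by positivity) |>.2
  rw [← norm_pow, Complex.cosh_sq]
  refine (norm_add_le _ _).trans ?_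
  rw [norm_one, norm_pow]
  have := pow_le_pow_left₀ (norm_nonneg _) (norm_sinh_descentPath_le a) 2
  nlinarith

/-- Bessel's equation for the moments of the Hankel kernel. -/
theorem hankelMoment_bessel_equation (ν : ℝ) {x : ℝ} (hx : 0 < x) :
    (x : ℂ) ^ 2 * hankelMoment 2 ν x + x * hankelMoment 1 ν x +
      ((x : ℂ) ^ 2 - ν ^ 2) * hankelMoment 0 ν x = 0 := by
  -- The left side of Bessel's equation is the integral of a total derivative: `d/dw [(x cosh w + ν)
  -- k] = (x² sinh² w + x sinh w + x² - ν²) k` for the kernel `k`, by `cosh² = 1 + sinh²`.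
  have hd : ∀ a : ℝ, HasDerivAt
      (fun a => (x * Complex.cosh (descentPath a) + ν) * hankelKernel ν x (descentPath a))
      ((x : ℂ) ^ 2 * hankelIntegrand 2 ν x a + x * hankelIntegrand 1 ν x a +
      ((x : ℂ) ^ 2 - ν ^ 2) * hankelIntegrand 0 ν x a) a := fun a => by
    have h1 : HasDerivAt (fun w : ℂ => (x * Complex.cosh w + ν) * hankelKernel ν x w)
        ((x * Complex.sinh (descentPath a)) * hankelKernel ν x (descentPath a) +
          (x * Complex.cosh (descentPath a) + ν) * (hankelKernel ν x (descentPath a) *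
            (x * Complex.cosh (descentPath a) - ν * 1))) (descentPath a) :=
      (((Complex.hasDerivAt_cosh _).const_mul (x : ℂ)).add_const (ν : ℂ)).mul
        (((Complex.hasDerivAt_sinh _).const_mul (x : ℂ)).sub
          ((hasDerivAt_id _).const_mul (ν : ℂ))).cexp
    refine (hasDerivAt_comp_descentPath h1).congr_deriv ?_
    simp only [hankelIntegrand]
    linear_combination (x : ℂ) ^ 2 * hankelKernel ν x (descentPath a) * descentVel a *
      Complex.cosh_sq (descentPath a)
  have hi : ∀ (n : ℕ) (C : ℂ), Integrable fun a => C * hankelIntegrand n ν x a :=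
    fun n C => (integrable_hankelIntegrand n ν hx).const_mul C
  have hi' : Integrable fun a => (x : ℂ) ^ 2 * hankelIntegrand 2 ν x a +
      x * hankelIntegrand 1 ν x a := (hi 2 _).add (hi 1 _)
  have hlim : ∀ l : Filter ℝ, Tendsto (fun a => (2 * x + |ν|) * (Nat.factorial 1 *
      (2 / x) ^ 1 * Real.exp (x / 2)) * Real.exp (-(x / 4) * a ^ 2 + |ν| * |a|)) l (𝓝 0) →
      Tendsto (fun a => (x * Complex.cosh (descentPath a) + ν) *
        hankelKernel ν x (descentPath a)) l (𝓝 0) := fun l hl => by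
    refine squeeze_zero_norm (fun a => ?_) hl
    rw [norm_mul]
    have h1 : ‖(x : ℂ) * Complex.cosh (descentPath a) + ν‖ ≤
        (2 * x + |ν|) * (1 + descentRate a) := by
      refine (norm_add_le _ _).trans ?_
      rw [norm_mul, Complex.norm_real, Complex.norm_real, Real.norm_of_nonneg hx.le,
        Real.norm_eq_abs]
      have h2 := norm_cosh_descentPath_le a
      have h3 := descentRate_nonneg a
      have h4 := mul_nonneg (abs_nonneg ν) h3
      nlinarith
    have h5 := one_add_descentRate_pow_mul_norm_le 1 ν hx le_rfl a
    rw [pow_one] at h5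
    calc _ ≤ (2 * x + |ν|) * (1 + descentRate a) * ‖hankelKernel ν x (descentPath a)‖ := by gcongr
      _ = (2 * x + |ν|) * ((1 + descentRate a) * ‖hankelKernel ν x (descentPath a)‖) := by ring
      _ ≤ (2 * x + |ν|) * _ := mul_le_mul_of_nonneg_left h5 (by positivity)
      _ = _ := by ring
  have hl := tendsto_exp_quadratic_zero (c := x / 4) (by positivity) ((2 * x + |ν|) *
    (Nat.factorial 1 * (2 / x) ^ 1 * Real.exp (x / 2))) |ν|
  have h := integral_of_hasDerivAt_of_tendsto hd (hi'.add (hi 0 ((x : ℂ) ^ 2 - ν ^ 2)))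
    (hlim _ hl.2) (hlim _ hl.1)
  rw [integral_add hi' (hi 0 _), integral_add (hi 2 _) (hi 1 _), integral_const_mul,
    integral_const_mul, integral_const_mul, sub_zero] at h
  exact h

/-- The descent path is asymptotic to the real axis on the left and to height `π` on the right. The
vertical segments joining it to these lines stay where the kernel is small, so the primitive has the
same limits as along the Schläfli contour. -/
theorem hankelMoment_zero_eq (ν : ℝ) {x : ℝ} (hx : 0 < x) :
    hankelMoment 0 ν x = -(Real.pi * besselY ν x : ℝ) + (Real.pi * besselJ ν x : ℝ) * Complex.I := by
  obtain ⟨F, hF⟩ := exists_primitive_hankelKernel ν x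
  have hd : ∀ a : ℝ, HasDerivAt (fun a => F (descentPath a)) (hankelIntegrand 0 ν x a) a :=
    fun a => (hasDerivAt_comp_descentPath (hF _)).congr_deriv (by simp [hankelIntegrand])
  have hbound : Tendsto (fun R : ℝ => Real.exp (-(x / 2) * R ^ 2 + |ν| * |R|) * (Real.pi))
      atTop (𝓝 0) := by
    simpa using (tendsto_exp_neg_sq_add_abs (half_pos hx) |ν|).mul_const Real.pi
  have hM : ∀ R c : ℝ, 0 ≤ R → Real.sinh R / Real.cosh R ≤ c → ∀ t : ℝ, |t| = R →
      -(x * Real.sinh R * c) - ν * t ≤ -(x / 2) * R ^ 2 + |ν| * |R| := fun R c hR hc t ht => by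
    have h1 := half_sq_le_descentRate R
    have h2 : descentRate R ≤ Real.sinh R * c := by
      rw [descentRate, sq, mul_div_assoc]
      exact mul_le_mul_of_nonneg_left hc (Real.sinh_nonneg_iff.mpr hR)
    have h3 : -ν * t ≤ |ν| * |R| := by
      rw [abs_of_nonneg hR, ← ht, ← abs_mul]
      exact (le_abs_self _).trans (by rw [neg_mul, abs_neg])
    nlinarith
  have harc : ∀ R : ℝ, 0 ≤ R → 0 ≤ Real.arctan (Real.sinh R) ∧
      Real.arctan (Real.sinh R) < Real.pi / 2 := fun R hR =>
    ⟨Real.arctan_nonneg.mpr (Real.sinh_nonneg_iff.mpr hR), Real.arctan_lt_pi_div_two _⟩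
  have htop : Tendsto (fun R : ℝ => F (descentPath R)) atTop
      (𝓝 (F 0 - schlafliExp ν x - (Real.pi * besselY ν x : ℝ) +
        (Real.pi * besselJ ν x : ℝ) * Complex.I)) := by
    have h := tendsto_primitive_add_pi_mul_I hx hF
    have h0 : Tendsto (fun R : ℝ => F (R + Real.pi * Complex.I) - F (descentPath R)) atTop
        (𝓝 0) := by
      refine squeeze_zero_norm' ?_ hbound
      filter_upwards [eventually_ge_atTop 0] with R hR
      obtain ⟨h1, h2⟩ := harc R hR
      refine (norm_primitive_sub_vertical_le hF (M := -(x / 2) * R ^ 2 + |ν| * |R|)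
        (by linarith) fun b hb => ?_).trans
        (mul_le_mul_of_nonneg_left (by linarith [Real.pi_pos]) (Real.exp_pos _).le)
      have h3 : Real.cos b ≤ -(Real.sinh R / Real.cosh R) := by
        rw [← cos_pi_div_two_add_arctan_sinh]
        exact Real.cos_le_cos_of_nonneg_of_le_pi (by linarith [Real.pi_pos]) hb.2 hb.1
      have h4 := hM R (-Real.cos b) hR (by linarith) R (abs_of_nonneg hR)
      linarith
    simpa using h.sub h0
  have hbot : Tendsto (fun R : ℝ => F (descentPath R)) atBot (𝓝 (F 0 - schlafliExp ν x)) := by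
    have h := tendsto_primitive_neg hx hF
    have h0 : Tendsto (fun R : ℝ => F (descentPath (-R)) - F (-R)) atTop (𝓝 0) := by
      refine squeeze_zero_norm' ?_ hbound
      filter_upwards [eventually_ge_atTop 0] with R hR
      obtain ⟨h1, h2⟩ := harc R hR
      have h5 := norm_primitive_sub_vertical_le hF (a := -R) (b₁ := 0)
        (b₂ := Real.pi / 2 + Real.arctan (Real.sinh (-R)))
        (M := -(x / 2) * R ^ 2 + |ν| * |R|)
        (by rw [Real.sinh_neg, Real.arctan_neg]; linarith) fun b hb => ?_
      · rw [Complex.ofReal_zero, zero_mul, add_zero, Complex.ofReal_neg] at h5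
        have e : descentPath (-R) = -(R : ℂ) +
            ((Real.pi / 2 + Real.arctan (Real.sinh (-R)) : ℝ) : ℂ) * Complex.I := by
          rw [descentPath, Complex.ofReal_neg]
        rw [e]
        refine h5.trans (mul_le_mul_of_nonneg_left ?_ (Real.exp_pos _).le)
        rw [Real.sinh_neg, Real.arctan_neg]; linarith [Real.pi_pos]
      · have h3 : Real.sinh R / Real.cosh R ≤ Real.cos b := by
          have e : Real.sinh R / Real.cosh R =
              Real.cos (Real.pi / 2 + Real.arctan (Real.sinh (-R))) := by
            rw [cos_pi_div_two_add_arctan_sinh, Real.sinh_neg, Real.cosh_neg]; ring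
          rw [e]
          refine Real.cos_le_cos_of_nonneg_of_le_pi hb.1 ?_ hb.2
          rw [Real.sinh_neg, Real.arctan_neg]; linarith [Real.pi_pos]
        have h4 := hM R (Real.cos b) hR h3 (-R) (by rw [abs_neg, abs_of_nonneg hR])
        rw [Real.sinh_neg]
        linarith
    have h6 := (h.add h0).comp tendsto_neg_atBot_atTop
    simpa [Function.comp_def] using h6
  rw [hankelMoment, integral_of_hasDerivAt_of_tendsto hd (integrable_hankelIntegrand 0 ν hx)
    hbot htop]
  ring

/-! ### Behaviour at infinity -/

theorem tendsto_mul_descentRate_div_sqrt (y : ℝ) :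
    Tendsto (fun x : ℝ => x * descentRate (y / √x)) atTop (𝓝 (y ^ 2)) := by
  have ht : Tendsto (fun x : ℝ => (√x)⁻¹) atTop (𝓝[>] 0) :=
    tendsto_inv_atTop_nhdsGT_zero.comp Real.tendsto_sqrt_atTop
  have ht' : Tendsto (fun x : ℝ => (√x)⁻¹) atTop (𝓝 0) := ht.mono_right nhdsWithin_le_nhds
  have hd : HasDerivAt (fun t : ℝ => Real.sinh (y * t)) y 0 := by
    have h := ((hasDerivAt_id (0 : ℝ)).const_mul y).sinh
    simpa using h
  have h1 := hd.tendsto_slope_zero_right.comp ht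
  have h2 : Tendsto (fun x : ℝ => Real.cosh (y * (√x)⁻¹)) atTop (𝓝 1) := by
    have := (Real.continuous_cosh.tendsto (y * 0)).comp (ht'.const_mul y)
    simpa [Function.comp_def] using this
  have h3 := (h1.pow 2).div h2 one_ne_zero
  rw [div_one] at h3
  refine h3.congr' ?_
  filter_upwards [eventually_gt_atTop 0] with x hx
  have hs : √x ^ 2 = x := Real.sq_sqrt hx.le
  simp only [Function.comp, Pi.div_apply, zero_add, mul_zero, Real.sinh_zero, sub_zero, inv_inv,
    smul_eq_mul, descentRate, mul_pow, hs, ← div_eq_mul_inv]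
  ring

theorem hankelIntegrand_zero_eq (ν x a : ℝ) :
    hankelIntegrand 0 ν x a = Complex.exp (x * Complex.I) *
      (Complex.exp ((-(x * descentRate a) : ℝ) : ℂ) *
        (Complex.exp (-(ν * descentPath a)) * descentVel a)) := by
  rw [hankelIntegrand, hankelKernel, sinh_descentPath, pow_zero, one_mul, ← mul_assoc, ← mul_assoc,
    ← Complex.exp_add, ← Complex.exp_add]
  congr 2
  push_cast; ring

/-- The limit of `√x e^{-ix}` times the zeroth moment of the Hankel kernel. -/
noncomputable def hankelAmplitude (ν : ℝ) : ℂ :=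
  √Real.pi * (Complex.exp (-(ν * descentPath 0)) * descentVel 0)

theorem norm_exp_descentPath (ν a : ℝ) :
    ‖Complex.exp (-(ν * descentPath a))‖ = Real.exp (-(ν * a)) := by
  rw [Complex.norm_exp, Complex.neg_re, Complex.re_ofReal_mul, descentPath, Complex.add_re,
    Complex.re_ofReal_mul, Complex.ofReal_re, Complex.I_re, mul_zero, add_zero]

theorem norm_hankelAmplitude_sq (ν : ℝ) : ‖hankelAmplitude ν‖ ^ 2 = 2 * Real.pi := by
  rw [hankelAmplitude, norm_mul, norm_mul, norm_exp_descentPath, mul_zero, neg_zero, Real.exp_zero,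
    one_mul, mul_pow, Complex.norm_real, Real.norm_of_nonneg (Real.sqrt_nonneg _),
    Real.sq_sqrt Real.pi_pos.le, ← Complex.normSq_eq_norm_sq, descentVel]
  simp [Complex.normSq_apply]
  ring

theorem neg_mul_le_abs_mul_abs (ν a : ℝ) : -(ν * a) ≤ |ν| * |a| := by
  rw [← abs_mul]; exact neg_le_abs _

/-- Laplace's method: after the substitution `a = y / √x` the exponent tends to `-y²` and the
remaining factors to their values at `a = 0`, with a fixed integrable majorant for `x ≥ 1`. -/
theorem tendsto_sqrt_mul_hankelMoment_zero (ν : ℝ) :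
    Tendsto (fun x : ℝ => Complex.exp (-(x * Complex.I)) * (√x * hankelMoment 0 ν x)) atTop
      (𝓝 (hankelAmplitude ν)) := by
  have hlim : Tendsto (fun x : ℝ => ∫ y : ℝ,
      Complex.exp ((-(x * descentRate (y / √x)) : ℝ) : ℂ) *
        (Complex.exp (-(ν * descentPath (y / √x))) * descentVel (y / √x))) atTop
      (𝓝 (∫ y : ℝ, Complex.exp ((-(y ^ 2) : ℝ) : ℂ) *
        (Complex.exp (-(ν * descentPath 0)) * descentVel 0))) := by
    refine tendsto_integral_filter_of_dominated_convergence
      (fun y => 2 * Real.exp (-(1 / 2) * y ^ 2 + |ν| * |y|)) ?_ ?_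
      ((integrable_exp_neg_sq_add_abs (by norm_num) _).const_mul _) ?_
    · refine Eventually.of_forall fun x => Continuous.aestronglyMeasurable ?_
      have h1 := continuous_descentRate
      have h2 := continuous_descentPath
      have h3 := continuous_descentVel
      fun_prop
    · filter_upwards [eventually_ge_atTop 1] with x hx
      refine Eventually.of_forall fun y => ?_
      have hx0 : 0 < x := by linarith
      rw [norm_mul, norm_mul, norm_exp_descentPath, ← Complex.ofReal_exp, Complex.norm_real,
        Real.norm_of_nonneg (Real.exp_pos _).le]
      have h1 : y ^ 2 / 2 ≤ x * descentRate (y / √x) := by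
        have := mul_le_mul_of_nonneg_left (half_sq_le_descentRate (y / √x)) hx0.le
        rw [div_pow, Real.sq_sqrt hx0.le] at this
        calc y ^ 2 / 2 = x * (y ^ 2 / x / 2) := by field_simp
          _ ≤ _ := this
      have h2 : -(ν * (y / √x)) ≤ |ν| * |y| := by
        refine (neg_mul_le_abs_mul_abs _ _).trans (mul_le_mul_of_nonneg_left ?_ (abs_nonneg _))
        rw [abs_div, abs_of_nonneg (Real.sqrt_nonneg x)]
        exact div_le_self (abs_nonneg _) (Real.one_le_sqrt.mpr hx)
      calc _ ≤ Real.exp (-(x * descentRate (y / √x))) *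
            (Real.exp (-(ν * (y / √x))) * 2) := by
            gcongr; exact norm_descentVel_le _
        _ = 2 * Real.exp (-(x * descentRate (y / √x)) + -(ν * (y / √x))) := by
            rw [Real.exp_add]; ring
        _ ≤ _ := by
            refine mul_le_mul_of_nonneg_left (Real.exp_le_exp.mpr ?_) zero_le_two
            linarith
    · refine Eventually.of_forall fun y => ?_
      have hy : Tendsto (fun x : ℝ => y / √x) atTop (𝓝 0) :=
        Real.tendsto_sqrt_atTop.const_div_atTop y
      have h1 : Tendsto (fun x : ℝ => Complex.exp ((-(x * descentRate (y / √x)) : ℝ) : ℂ)) atTop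
          (𝓝 (Complex.exp ((-(y ^ 2) : ℝ) : ℂ))) :=
        (Complex.continuous_exp.comp Complex.continuous_ofReal).continuousAt.tendsto.comp
          (tendsto_mul_descentRate_div_sqrt y).neg
      have hc : Continuous fun a => Complex.exp (-(ν * descentPath a)) * descentVel a := by
        have h2 := continuous_descentPath
        have h3 := continuous_descentVel
        fun_prop
      exact h1.mul ((hc.tendsto 0).comp hy)
  have hval : ∫ y : ℝ, Complex.exp ((-(y ^ 2) : ℝ) : ℂ) *
        (Complex.exp (-(ν * descentPath 0)) * descentVel 0) = hankelAmplitude ν := by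
    rw [integral_mul_const, hankelAmplitude]
    congr 1
    have h := integral_gaussian 1
    simp only [neg_mul, one_mul, div_one] at h
    rw [← h, ← integral_complex_ofReal]
    simp only [Complex.ofReal_exp]
  rw [hval] at hlim
  refine hlim.congr' ?_
  filter_upwards [eventually_gt_atTop 0] with x hx
  have h := Measure.integral_comp_div (fun a => Complex.exp ((-(x * descentRate a) : ℝ) : ℂ) *
        (Complex.exp (-(ν * descentPath a)) * descentVel a)) (√x)
  rw [h, hankelMoment]
  simp_rw [hankelIntegrand_zero_eq]
  rw [integral_const_mul, abs_of_nonneg (Real.sqrt_nonneg x), Complex.real_smul, Complex.exp_neg]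
  have := Complex.exp_ne_zero (x * Complex.I)
  field_simp

/-- Along the path `sinh w - i = -descentRate a`, a factor of order `1/x` on the effective range of
integration; so the derivative of `J + i Y` is asymptotically `i (J + i Y)`. -/
theorem tendsto_sqrt_mul_hankelMoment_one_sub (ν : ℝ) :
    Tendsto (fun x : ℝ => √x * (hankelMoment 1 ν x - Complex.I * hankelMoment 0 ν x)) atTop
      (𝓝 0) := by
  have hb : Tendsto (fun x : ℝ => 4 * (√x)⁻¹ * ∫ a : ℝ, Real.exp (-(1 / 4) * a ^ 2 + |ν| * |a|))
      atTop (𝓝 0) := by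
    generalize ∫ a : ℝ, Real.exp (-(1 / 4) * a ^ 2 + |ν| * |a|) = C
    simpa using (((tendsto_inv_atTop_zero.comp Real.tendsto_sqrt_atTop).const_mul 4).mul_const C)
  refine squeeze_zero_norm' ?_ hb
  filter_upwards [eventually_ge_atTop 1] with x hx
  have hx0 : 0 < x := by linarith
  have e : hankelMoment 1 ν x - Complex.I * hankelMoment 0 ν x =
      ∫ a : ℝ, -(descentRate a : ℂ) * hankelIntegrand 0 ν x a := by
    rw [hankelMoment, hankelMoment, ← integral_const_mul, ← integral_sub
      (integrable_hankelIntegrand 1 ν hx0) ((integrable_hankelIntegrand 0 ν hx0).const_mul _)]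
    congr 1
    ext a
    simp only [hankelIntegrand, sinh_descentPath]
    ring
  have hpt : ∀ a : ℝ, ‖-(descentRate a : ℂ) * hankelIntegrand 0 ν x a‖ ≤
      4 / x * Real.exp (-(1 / 4) * a ^ 2 + |ν| * |a|) := fun a => by
    have h0 := descentRate_nonneg a
    rw [hankelIntegrand, pow_zero, one_mul, norm_mul, norm_mul, norm_neg, Complex.norm_real,
      Real.norm_of_nonneg h0, norm_hankelKernel_descentPath]
    -- Half of the exponential decay is spent on the factor `descentRate a`, which gains `1/x`.
    have h1 : descentRate a ≤ 2 / x * Real.exp (x / 2 * descentRate a) := by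
      have := Real.add_one_le_exp (x / 2 * descentRate a)
      calc descentRate a = 2 / x * (x / 2 * descentRate a) := by field_simp
        _ ≤ _ := by gcongr; linarith
    have h2 : Real.exp (x / 2 * descentRate a) * Real.exp (-(x * descentRate a) - ν * a) ≤
        Real.exp (-(1 / 4) * a ^ 2 + |ν| * |a|) := by
      rw [← Real.exp_add]
      refine Real.exp_le_exp.mpr ?_
      have h3 := half_sq_le_descentRate a
      have h4 := neg_mul_le_abs_mul_abs ν a
      nlinarith
    calc _ ≤ (2 / x * Real.exp (x / 2 * descentRate a)) *
          (Real.exp (-(x * descentRate a) - ν * a) * 2) := by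
          gcongr; exact norm_descentVel_le a
      _ = 4 / x * (Real.exp (x / 2 * descentRate a) *
          Real.exp (-(x * descentRate a) - ν * a)) := by ring
      _ ≤ _ := by gcongr
  have h := norm_integral_le_of_norm_le
    ((integrable_exp_neg_sq_add_abs (c := 1 / 4) (by norm_num) |ν|).const_mul (4 / x))
    (Eventually.of_forall hpt)
  rw [integral_const_mul] at h
  rw [e, norm_mul, Complex.norm_real, Real.norm_of_nonneg (Real.sqrt_nonneg _)]
  calc _ ≤ √x * (4 / x * ∫ a : ℝ, Real.exp (-(1 / 4) * a ^ 2 + |ν| * |a|)) := by gcongr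
    _ = _ := by
      have : √x * (4 / x) = 4 * (√x)⁻¹ := by
        have hs : √x ≠ 0 := (Real.sqrt_pos.mpr hx0).ne'
        field_simp
        exact Real.sq_sqrt hx0.le
      rw [← mul_assoc, this]

/-! ### Bessel's equation in normal form -/

/-- A pair of solutions of `u'' + q u = 0` on `(0, ∞)` that behaves at infinity like
`√W (cos (x + c), sin (x + c))`; `v₁` and `v₂` are the derivatives. -/
structure IsPhasePair (q u₁ u₂ v₁ v₂ : ℝ → ℝ) (W : ℝ) : Prop where
  deriv_fst : ∀ x, 0 < x → HasDerivAt u₁ (v₁ x) x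
  deriv_snd : ∀ x, 0 < x → HasDerivAt u₂ (v₂ x) x
  deriv_deriv_fst : ∀ x, 0 < x → HasDerivAt v₁ (-(q x * u₁ x)) x
  deriv_deriv_snd : ∀ x, 0 < x → HasDerivAt v₂ (-(q x * u₂ x)) x
  tendsto_sq_add_sq : Tendsto (fun x => u₁ x ^ 2 + u₂ x ^ 2) atTop (𝓝 W)
  tendsto_add : Tendsto (fun x => v₁ x + u₂ x) atTop (𝓝 0)
  tendsto_sub : Tendsto (fun x => v₂ x - u₁ x) atTop (𝓝 0)

/-- The derivative of the Bessel function of the first kind. -/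
noncomputable def besselJDeriv (ν x : ℝ) : ℝ := (hankelMoment 1 ν x).im / Real.pi

/-- The derivative of the Bessel function of the second kind. -/
noncomputable def besselYDeriv (ν x : ℝ) : ℝ := -(hankelMoment 1 ν x).re / Real.pi

theorem besselJ_eq_im (ν : ℝ) {x : ℝ} (hx : 0 < x) :
    besselJ ν x = (hankelMoment 0 ν x).im / Real.pi := by
  rw [hankelMoment_zero_eq ν hx, ← Complex.ofReal_neg, ← Complex.mk_eq_add_mul_I,
    mul_div_cancel_left₀ _ Real.pi_ne_zero]

theorem besselY_eq_re (ν : ℝ) {x : ℝ} (hx : 0 < x) :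
    besselY ν x = -(hankelMoment 0 ν x).re / Real.pi := by
  rw [hankelMoment_zero_eq ν hx, ← Complex.ofReal_neg, ← Complex.mk_eq_add_mul_I, neg_neg,
    mul_div_cancel_left₀ _ Real.pi_ne_zero]

theorem hasDerivAt_im_hankelMoment (n : ℕ) (ν : ℝ) {x : ℝ} (hx : 0 < x) :
    HasDerivAt (fun x => (hankelMoment n ν x).im) (hankelMoment (n + 1) ν x).im x :=
  Complex.imCLM.hasFDerivAt.comp_hasDerivAt x (hasDerivAt_hankelMoment n ν hx)

theorem hasDerivAt_re_hankelMoment (n : ℕ) (ν : ℝ) {x : ℝ} (hx : 0 < x) :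
    HasDerivAt (fun x => (hankelMoment n ν x).re) (hankelMoment (n + 1) ν x).re x :=
  Complex.reCLM.hasFDerivAt.comp_hasDerivAt x (hasDerivAt_hankelMoment n ν hx)

theorem hasDerivAt_besselJ (ν : ℝ) {x : ℝ} (hx : 0 < x) :
    HasDerivAt (besselJ ν) (besselJDeriv ν x) x :=
  ((hasDerivAt_im_hankelMoment 0 ν hx).div_const Real.pi).congr_of_eventuallyEq
    (by filter_upwards [Ioi_mem_nhds hx] with y hy using besselJ_eq_im ν hy)

theorem hasDerivAt_besselY (ν : ℝ) {x : ℝ} (hx : 0 < x) :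
    HasDerivAt (besselY ν) (besselYDeriv ν x) x :=
  ((hasDerivAt_re_hankelMoment 0 ν hx).neg.div_const Real.pi).congr_of_eventuallyEq
    (by filter_upwards [Ioi_mem_nhds hx] with y hy using besselY_eq_re ν hy)

theorem hasDerivAt_besselJDeriv (ν : ℝ) {x : ℝ} (hx : 0 < x) :
    HasDerivAt (besselJDeriv ν)
      (-(besselJDeriv ν x / x + (1 - ν ^ 2 / x ^ 2) * besselJ ν x)) x := by
  refine ((hasDerivAt_im_hankelMoment 1 ν hx).div_const Real.pi).congr_deriv ?_
  have h := congrArg Complex.im (hankelMoment_bessel_equation ν hx)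
  have e : ((x : ℂ) ^ 2 - (ν : ℂ) ^ 2) = ((x ^ 2 - ν ^ 2 : ℝ) : ℂ) := by push_cast; rfl
  rw [e, ← Complex.ofReal_pow, Complex.add_im, Complex.add_im, Complex.im_ofReal_mul,
    Complex.im_ofReal_mul, Complex.im_ofReal_mul, Complex.zero_im] at h
  rw [besselJDeriv, besselJ_eq_im ν hx]
  field_simp
  linear_combination h

theorem hasDerivAt_besselYDeriv (ν : ℝ) {x : ℝ} (hx : 0 < x) :
    HasDerivAt (besselYDeriv ν)
      (-(besselYDeriv ν x / x + (1 - ν ^ 2 / x ^ 2) * besselY ν x)) x := by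
  refine ((hasDerivAt_re_hankelMoment 1 ν hx).neg.div_const Real.pi).congr_deriv ?_
  have h := congrArg Complex.re (hankelMoment_bessel_equation ν hx)
  have e : ((x : ℂ) ^ 2 - (ν : ℂ) ^ 2) = ((x ^ 2 - ν ^ 2 : ℝ) : ℂ) := by push_cast; rfl
  rw [e, ← Complex.ofReal_pow, Complex.add_re, Complex.add_re, Complex.re_ofReal_mul,
    Complex.re_ofReal_mul, Complex.re_ofReal_mul, Complex.zero_re] at h
  rw [besselYDeriv, besselY_eq_re ν hx]
  field_simp
  linear_combination -h

/-- The potential of Bessel's equation in normal form. -/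
noncomputable def besselPotential (ν x : ℝ) : ℝ := 1 - (ν ^ 2 - 1 / 4) / x ^ 2

theorem hasDerivAt_sqrt_mul {f f' : ℝ → ℝ} {x : ℝ} (hx : 0 < x) (hf : HasDerivAt f (f' x) x) :
    HasDerivAt (fun x => √x * f x) (f x / (2 * √x) + √x * f' x) x := by
  refine ((Real.hasDerivAt_sqrt hx.ne').mul hf).congr_deriv ?_
  ring

theorem hasDerivAt_deriv_sqrt_mul {ν : ℝ} {f f' : ℝ → ℝ} {x : ℝ} (hx : 0 < x)
    (hf : HasDerivAt f (f' x) x)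
    (hf' : HasDerivAt f' (-(f' x / x + (1 - ν ^ 2 / x ^ 2) * f x)) x) :
    HasDerivAt (fun x => f x / (2 * √x) + √x * f' x) (-(besselPotential ν x * (√x * f x))) x := by
  have hs : 0 < √x := Real.sqrt_pos.mpr hx
  have h1 := hf.div ((Real.hasDerivAt_sqrt hx.ne').const_mul 2) (by positivity)
  have h2 := (Real.hasDerivAt_sqrt hx.ne').mul hf'
  refine (h1.add h2).congr_deriv ?_
  rw [besselPotential]
  have hx2 : x = √x ^ 2 := (Real.sq_sqrt hx.le).symm
  generalize √x = s at *
  subst hx2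
  field_simp
  ring

theorem tendsto_norm_sqrt_mul_hankelMoment_zero (ν : ℝ) :
    Tendsto (fun x : ℝ => √x * ‖hankelMoment 0 ν x‖) atTop (𝓝 ‖hankelAmplitude ν‖) := by
  refine (tendsto_sqrt_mul_hankelMoment_zero ν).norm.congr fun x => ?_
  rw [norm_mul, Complex.norm_exp, norm_mul, Complex.norm_real,
    Real.norm_of_nonneg (Real.sqrt_nonneg _)]
  simp

theorem tendsto_div_sqrt_of_abs_le_norm {ν : ℝ} {f : ℝ → ℝ}
    (hf : ∀ x, 0 < x → |f x| ≤ ‖hankelMoment 0 ν x‖ / Real.pi) :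
    Tendsto (fun x => f x / (2 * √x)) atTop (𝓝 0) := by
  have h := ((tendsto_norm_sqrt_mul_hankelMoment_zero ν).mul tendsto_inv_atTop_zero).div_const
    (2 * Real.pi)
  rw [mul_zero, zero_div] at h
  refine squeeze_zero_norm' ?_ h
  filter_upwards [eventually_gt_atTop 0] with x hx
  have hs : 0 < √x := Real.sqrt_pos.mpr hx
  rw [Real.norm_eq_abs, abs_div, abs_of_pos (by positivity : 0 < 2 * √x)]
  have hx2 : x = √x ^ 2 := (Real.sq_sqrt hx.le).symm
  calc _ ≤ ‖hankelMoment 0 ν x‖ / Real.pi / (2 * √x) := by gcongr; exact hf x hx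
    _ = √x * ‖hankelMoment 0 ν x‖ * (√x ^ 2)⁻¹ / (2 * Real.pi) := by
      have := Real.pi_pos
      field_simp
    _ = _ := by rw [← hx2]

theorem isPhasePair_bessel (ν : ℝ) :
    IsPhasePair (besselPotential ν) (fun x => √x * besselJ ν x) (fun x => √x * besselY ν x)
      (fun x => besselJ ν x / (2 * √x) + √x * besselJDeriv ν x)
      (fun x => besselY ν x / (2 * √x) + √x * besselYDeriv ν x) (2 / Real.pi) where
  deriv_fst x hx := hasDerivAt_sqrt_mul hx (hasDerivAt_besselJ ν hx)
  deriv_snd x hx := hasDerivAt_sqrt_mul hx (hasDerivAt_besselY ν hx)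
  deriv_deriv_fst x hx := hasDerivAt_deriv_sqrt_mul hx (hasDerivAt_besselJ ν hx)
    (hasDerivAt_besselJDeriv ν hx)
  deriv_deriv_snd x hx := hasDerivAt_deriv_sqrt_mul hx (hasDerivAt_besselY ν hx)
    (hasDerivAt_besselYDeriv ν hx)
  tendsto_sq_add_sq := by
    have h := ((tendsto_norm_sqrt_mul_hankelMoment_zero ν).pow 2).div_const (Real.pi ^ 2)
    have e : ‖hankelAmplitude ν‖ ^ 2 / Real.pi ^ 2 = 2 / Real.pi := by
      rw [norm_hankelAmplitude_sq]
      have := Real.pi_ne_zero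
      field_simp
    rw [e] at h
    refine h.congr' ?_
    filter_upwards [eventually_gt_atTop 0] with x hx
    rw [mul_pow, ← Complex.normSq_eq_norm_sq, Complex.normSq_apply, besselJ_eq_im ν hx,
      besselY_eq_re ν hx]
    ring
  tendsto_add := by
    have h1 := tendsto_div_sqrt_of_abs_le_norm (ν := ν) (f := besselJ ν) fun x hx => by
      rw [besselJ_eq_im ν hx, abs_div, abs_of_pos Real.pi_pos]
      exact div_le_div_of_nonneg_right (Complex.abs_im_le_norm _) Real.pi_pos.le
    have h2 := (((Complex.continuous_im.tendsto 0).comp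
      (tendsto_sqrt_mul_hankelMoment_one_sub ν)).div_const Real.pi)
    rw [Complex.zero_im, zero_div] at h2
    have h3 := h1.add h2
    rw [add_zero] at h3
    refine h3.congr' ?_
    filter_upwards [eventually_gt_atTop 0] with x hx
    rw [Function.comp, Complex.im_ofReal_mul, Complex.sub_im, Complex.I_mul_im, besselJDeriv,
      besselY_eq_re ν hx]
    ring
  tendsto_sub := by
    have h1 := tendsto_div_sqrt_of_abs_le_norm (ν := ν) (f := besselY ν) fun x hx => by
      rw [besselY_eq_re ν hx, abs_div, abs_of_pos Real.pi_pos, abs_neg]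
      exact div_le_div_of_nonneg_right (Complex.abs_re_le_norm _) Real.pi_pos.le
    have h2 := (((Complex.continuous_re.tendsto 0).comp
      (tendsto_sqrt_mul_hankelMoment_one_sub ν)).div_const Real.pi)
    rw [Complex.zero_re, zero_div] at h2
    have h3 := h1.sub h2
    rw [sub_zero] at h3
    refine h3.congr' ?_
    filter_upwards [eventually_gt_atTop 0] with x hx
    rw [Function.comp, Complex.re_ofReal_mul, Complex.sub_re, Complex.I_mul_re, besselYDeriv,
      besselJ_eq_im ν hx]
    ring

/-- `J_ν + Y_ν` takes positive values. -/
theorem exists_besselJ_add_besselY_pos (ν : ℝ) :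
    ∃ x, 0 < x ∧ 0 < besselJ ν x + besselY ν x := by
  set L := hankelAmplitude ν with hL
  have hLpos : 0 < ‖L‖ := by
    rw [norm_pos_iff]
    intro h0
    have h := norm_hankelAmplitude_sq ν
    rw [← hL, h0] at h
    simp [Real.pi_ne_zero] at h
  -- The phase is chosen so that along `x = c + 2πn` the rescaled `π i (J + i Y)` tends to a
  -- positive multiple of `i`. Its imaginary part minus its real part, which is `π √x (J + Y)`, is
  -- then eventually positive.
  set c : ℝ := Real.pi / 2 - L.arg with hc
  have hseq : Tendsto (fun n : ℕ => c + n * (2 * Real.pi)) atTop atTop :=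
    tendsto_atTop_add_const_left _ _
      (tendsto_natCast_atTop_atTop.atTop_mul_const Real.two_pi_pos)
  have hexp : Complex.exp (c * Complex.I) * L = ‖L‖ * Complex.I := by
    conv_lhs => rw [← Complex.norm_mul_exp_arg_mul_I L]
    rw [mul_left_comm, ← Complex.exp_add, ← add_mul, ← Complex.ofReal_add, hc, sub_add_cancel,
      Complex.ofReal_div, Complex.ofReal_ofNat, Complex.exp_pi_div_two_mul_I]
  have h1 := (((tendsto_sqrt_mul_hankelMoment_zero ν).comp hseq).const_mul
    (Complex.exp (c * Complex.I)))
  rw [← hL, hexp] at h1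
  have h2 := ((Complex.continuous_im.sub Complex.continuous_re).tendsto _).comp h1
  have h3 : (‖L‖ * Complex.I).im - (‖L‖ * Complex.I).re = ‖L‖ := by simp
  rw [Pi.sub_apply, h3] at h2
  obtain ⟨n, hn, hpos⟩ := ((h2.eventually_const_lt hLpos).and
    (hseq.eventually_gt_atTop 0)).exists
  refine ⟨_, hpos, ?_⟩
  set x := c + n * (2 * Real.pi) with hx
  have e : Complex.exp (c * Complex.I) * (Complex.exp (-(x * Complex.I)) *
      (√x * hankelMoment 0 ν x)) = √x * hankelMoment 0 ν x := by
    rw [← mul_assoc, ← Complex.exp_add]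
    have : (c : ℂ) * Complex.I + -(x * Complex.I) = ((-n : ℤ) : ℂ) * (2 * Real.pi * Complex.I) := by
      rw [hx]; push_cast; ring
    rw [this, Complex.exp_int_mul_two_pi_mul_I, one_mul]
  simp only [Function.comp, Pi.sub_apply, ← hx] at hn
  rw [e, Complex.im_ofReal_mul, Complex.re_ofReal_mul, ← mul_sub] at hn
  have h4 := pos_of_mul_pos_right hn (Real.sqrt_nonneg x)
  rw [besselJ_eq_im ν hpos, besselY_eq_re ν hpos, ← add_div, ← sub_eq_add_neg]
  exact div_pos h4 Real.pi_pos

/-! ### Energy estimates for `u₁² + u₂²` -/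

namespace IsPhasePair

variable {q u₁ u₂ v₁ v₂ : ℝ → ℝ} {W : ℝ}

theorem isBoundedUnder_fst (h : IsPhasePair q u₁ u₂ v₁ v₂ W) :
    IsBoundedUnder (· ≤ ·) atTop fun x => ‖u₁ x‖ := by
  have hev := h.tendsto_sq_add_sq.eventually_le_const (lt_add_one W)
  refine ⟨1 + (W + 1), (Filter.eventually_map.mpr ?_)⟩
  filter_upwards [hev] with x hx
  rw [Real.norm_eq_abs]
  have h1 := sq_abs (u₁ x)
  nlinarith [sq_nonneg (u₂ x), sq_nonneg (|u₁ x| - 1), abs_nonneg (u₁ x)]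

theorem isBoundedUnder_snd (h : IsPhasePair q u₁ u₂ v₁ v₂ W) :
    IsBoundedUnder (· ≤ ·) atTop fun x => ‖u₂ x‖ := by
  have hev := h.tendsto_sq_add_sq.eventually_le_const (lt_add_one W)
  refine ⟨1 + (W + 1), (Filter.eventually_map.mpr ?_)⟩
  filter_upwards [hev] with x hx
  rw [Real.norm_eq_abs]
  have h1 := sq_abs (u₂ x)
  nlinarith [sq_nonneg (u₁ x), sq_nonneg (|u₂ x| - 1), abs_nonneg (u₂ x)]

theorem tendsto_error_mul {f g : ℝ → ℝ} (hf : Tendsto f atTop (𝓝 0))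
    (hg : IsBoundedUnder (· ≤ ·) atTop fun x => ‖g x‖) :
    Tendsto (fun x => f x * g x) atTop (𝓝 0) :=
  hf.zero_mul_isBoundedUnder_le hg

/-- At infinity `v₁` may be replaced by `-u₂` and `q` by `1`, up to vanishing factors times bounded
functions. This and the next two limits are the entries of the quadratic form giving the energy of
any combination of `u₁` and `u₂`. -/
theorem tendsto_energy_fst (h : IsPhasePair q u₁ u₂ v₁ v₂ W) (hq : Tendsto q atTop (𝓝 1)) :
    Tendsto (fun x => v₁ x ^ 2 + q x * u₁ x ^ 2) atTop (𝓝 W) := by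
  have b1 := h.isBoundedUnder_fst
  have b2 := h.isBoundedUnder_snd
  have hq' : Tendsto (fun x => q x - 1) atTop (𝓝 0) := by simpa using hq.sub_const 1
  have t1 := tendsto_error_mul (tendsto_error_mul hq' b1) b1
  have t2 := tendsto_error_mul h.tendsto_add b2
  have t3 := h.tendsto_add.mul h.tendsto_add
  have t4 := ((h.tendsto_sq_add_sq.add t1).sub (t2.const_mul 2)).add t3
  simp only [mul_zero, add_zero, sub_zero] at t4
  refine t4.congr fun x => ?_
  ring

theorem tendsto_energy_snd (h : IsPhasePair q u₁ u₂ v₁ v₂ W) (hq : Tendsto q atTop (𝓝 1)) :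
    Tendsto (fun x => v₂ x ^ 2 + q x * u₂ x ^ 2) atTop (𝓝 W) := by
  have b1 := h.isBoundedUnder_fst
  have b2 := h.isBoundedUnder_snd
  have hq' : Tendsto (fun x => q x - 1) atTop (𝓝 0) := by simpa using hq.sub_const 1
  have t1 := tendsto_error_mul (tendsto_error_mul hq' b2) b2
  have t2 := tendsto_error_mul h.tendsto_sub b1
  have t3 := h.tendsto_sub.mul h.tendsto_sub
  have t4 := ((h.tendsto_sq_add_sq.add t1).add (t2.const_mul 2)).add t3
  simp only [mul_zero, add_zero] at t4
  refine t4.congr fun x => ?_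
  ring

theorem tendsto_energy_cross (h : IsPhasePair q u₁ u₂ v₁ v₂ W) (hq : Tendsto q atTop (𝓝 1)) :
    Tendsto (fun x => v₁ x * v₂ x + q x * (u₁ x * u₂ x)) atTop (𝓝 0) := by
  have b1 := h.isBoundedUnder_fst
  have b2 := h.isBoundedUnder_snd
  have hq' : Tendsto (fun x => q x - 1) atTop (𝓝 0) := by simpa using hq.sub_const 1
  have t1 := tendsto_error_mul (tendsto_error_mul hq' b1) b2
  have t2 := tendsto_error_mul h.tendsto_sub b2
  have t3 := tendsto_error_mul h.tendsto_add b1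
  have t4 := ((t1.sub t2).add t3).add (h.tendsto_add.mul h.tendsto_sub)
  simp only [mul_zero, add_zero, sub_zero] at t4
  refine t4.congr fun x => ?_
  ring

theorem eq_of_deriv_eq_zero_of_tendsto {f : ℝ → ℝ} {c : ℝ}
    (hf : ∀ x, 0 < x → HasDerivAt f 0 x) (hc : Tendsto f atTop (𝓝 c)) {x : ℝ} (hx : 0 < x) :
    f x = c := by
  have hconst : ∀ y, x ≤ y → f y = f x := fun y hy => by
    refine constant_of_has_deriv_right_zero
      (fun t ht => (hf t (hx.trans_le ht.1)).continuousAt.continuousWithinAt)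
      (fun t ht => (hf t (hx.trans_le ht.1)).hasDerivWithinAt) y ⟨hy, le_rfl⟩
  refine tendsto_nhds_unique (tendsto_const_nhds.congr' ?_) hc
  filter_upwards [eventually_ge_atTop x] with y hy using (hconst y hy).symm

theorem wronskian_eq (h : IsPhasePair q u₁ u₂ v₁ v₂ W) {x : ℝ} (hx : 0 < x) :
    u₁ x * v₂ x - u₂ x * v₁ x = W := by
  refine eq_of_deriv_eq_zero_of_tendsto (f := fun x => u₁ x * v₂ x - u₂ x * v₁ x)
    (fun y hy => ?_) ?_ hx
  · refine (((h.deriv_fst y hy).mul (h.deriv_deriv_snd y hy)).sub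
      ((h.deriv_snd y hy).mul (h.deriv_deriv_fst y hy))).congr_deriv ?_
    ring
  · have t1 := tendsto_error_mul h.tendsto_sub h.isBoundedUnder_fst
    have t2 := tendsto_error_mul h.tendsto_add h.isBoundedUnder_snd
    have t3 := (h.tendsto_sq_add_sq.add t1).sub t2
    simp only [add_zero, sub_zero] at t3
    refine t3.congr fun x => ?_
    ring

/-- If the potential is nonincreasing, then `u₁² + u₂²` is at most its limit at infinity. -/
theorem sq_add_sq_le (h : IsPhasePair q u₁ u₂ v₁ v₂ W) (hW : 0 < W) (hq : Tendsto q atTop (𝓝 1))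
    {q' : ℝ → ℝ} (hq' : ∀ x, 0 < x → HasDerivAt q (q' x) x) (hneg : ∀ x, 0 < x → q' x ≤ 0)
    {x : ℝ} (hx : 0 < x) : u₁ x ^ 2 + u₂ x ^ 2 ≤ W := by
  set a := u₁ x with ha
  set b := u₂ x with hb
  -- The energy of the solution `a u₂ - b u₁`, which vanishes at `x` and has slope `W` there. Its
  -- derivative is `q'` times a square; its value at `x` is `W²` and its limit is `(a² + b²) W`.
  set E : ℝ → ℝ := fun t => (a * v₂ t - b * v₁ t) ^ 2 + q t * (a * u₂ t - b * u₁ t) ^ 2 with hE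
  have hE' : ∀ t, 0 < t → HasDerivAt E (q' t * (a * u₂ t - b * u₁ t) ^ 2) t := fun t ht => by
    have h1 := ((h.deriv_snd t ht).const_mul a).sub ((h.deriv_fst t ht).const_mul b)
    have h2 := ((h.deriv_deriv_snd t ht).const_mul a).sub ((h.deriv_deriv_fst t ht).const_mul b)
    refine ((h2.pow 2).add ((hq' t ht).mul (h1.pow 2))).congr_deriv ?_
    simp only [Pi.sub_apply, Pi.pow_apply]
    ring
  have hanti : AntitoneOn E (Ioi 0) := by
    refine antitoneOn_of_hasDerivWithinAt_nonpos (f' := fun t => q' t * (a * u₂ t - b * u₁ t) ^ 2)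
      (convex_Ioi 0)
      (fun t ht => (hE' t ht).continuousAt.continuousWithinAt) (fun t ht => ?_) fun t ht => ?_
    · exact (hE' t (by simpa using ht)).hasDerivWithinAt
    · exact mul_nonpos_of_nonpos_of_nonneg (hneg t (by simpa using ht)) (sq_nonneg _)
  have hlim : Tendsto E atTop (𝓝 ((a ^ 2 + b ^ 2) * W)) := by
    have t := (((h.tendsto_energy_snd hq).const_mul (a ^ 2)).add
      ((h.tendsto_energy_fst hq).const_mul (b ^ 2))).sub
      ((h.tendsto_energy_cross hq).const_mul (2 * a * b))
    rw [mul_zero, sub_zero, ← add_mul] at t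
    refine t.congr fun y => ?_
    simp only [hE]; ring
  have hle : (a ^ 2 + b ^ 2) * W ≤ E x := by
    refine le_of_tendsto hlim ?_
    filter_upwards [eventually_ge_atTop x] with y hy
    exact hanti hx (hx.trans_le hy) hy
  have hEx : E x = W ^ 2 := by
    rw [← h.wronskian_eq hx]
    simp only [hE, ← ha, ← hb]; ring
  rw [hEx, sq W] at hle
  exact le_of_mul_le_mul_right hle hW

end IsPhasePair

/-- Let `u₁, u₂` solve `u'' + q u = 0` where `q` is increasing and strictly concave. If
`N = u₁² + u₂²` is critical to second order at `R`, then it is nonincreasing on `(0, R]`. -/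
theorem antitoneOn_sq_add_sq_of_critical {q q' q'' u₁ u₂ v₁ v₂ : ℝ → ℝ} {R : ℝ}
    (hq : ∀ x, 0 < x → HasDerivAt q (q' x) x) (hq' : ∀ x, 0 < x → HasDerivAt q' (q'' x) x)
    (hq1 : ∀ x, 0 < x → 0 < q' x) (hq2 : ∀ x, 0 < x → q'' x < 0)
    (d1 : ∀ x, 0 < x → HasDerivAt u₁ (v₁ x) x) (d2 : ∀ x, 0 < x → HasDerivAt u₂ (v₂ x) x)
    (d3 : ∀ x, 0 < x → HasDerivAt v₁ (-(q x * u₁ x)) x)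
    (d4 : ∀ x, 0 < x → HasDerivAt v₂ (-(q x * u₂ x)) x)
    (hR : 0 < R) (hN : ∀ x, 0 < x → 0 < u₁ x ^ 2 + u₂ x ^ 2)
    (hP : u₁ R * v₁ R + u₂ R * v₂ R = 0)
    (hS : v₁ R ^ 2 + v₂ R ^ 2 = q R * (u₁ R ^ 2 + u₂ R ^ 2)) :
    AntitoneOn (fun x => u₁ x ^ 2 + u₂ x ^ 2) (Ioc 0 R) := by
  set N : ℝ → ℝ := fun x => u₁ x ^ 2 + u₂ x ^ 2 with hNdef
  set P : ℝ → ℝ := fun x => 2 * (u₁ x * v₁ x + u₂ x * v₂ x) with hPdef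
  set S : ℝ → ℝ := fun x => 2 * (v₁ x ^ 2 + v₂ x ^ 2 - q x * N x) with hSdef
  have dN : ∀ x, 0 < x → HasDerivAt N (P x) x := fun x hx => by
    refine (((d1 x hx).pow 2).add ((d2 x hx).pow 2)).congr_deriv ?_
    simp only [hPdef]; ring
  have dP : ∀ x, 0 < x → HasDerivAt P (S x) x := fun x hx => by
    refine ((((d1 x hx).mul (d3 x hx)).add ((d2 x hx).mul (d4 x hx))).const_mul 2).congr_deriv ?_
    simp only [hSdef, hNdef]; ring
  -- Appell's equation `N''' + 4 q N' + 2 q' N = 0` for `N = u₁² + u₂²`, with `P = N'` and `S =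
  -- N''`.
  have dS : ∀ x, 0 < x → HasDerivAt S (-(4 * q x * P x + 2 * q' x * N x)) x := fun x hx => by
    refine (((((d3 x hx).pow 2).add ((d4 x hx).pow 2)).sub
      ((hq x hx).mul (dN x hx))).const_mul 2).congr_deriv ?_
    simp only [hPdef, hNdef]; ring
  -- Multiplying Appell's equation by `2 N''` and integrating suggests this `E`. It increases
  -- wherever `P < 0`, vanishes at `R`, and equals `S² ≥ 0` at any zero of `P`; a last zero of `P`
  -- before `R` is therefore impossible.
  set E : ℝ → ℝ := fun x => S x ^ 2 + 4 * q x * P x ^ 2 + 4 * q' x * N x * P x with hEdef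
  have dE : ∀ x, 0 < x → HasDerivAt E (4 * P x * (2 * q' x * P x + q'' x * N x)) x :=
    fun x hx => by
      refine ((((dS x hx).pow 2).add (((hq x hx).const_mul 4).mul ((dP x hx).pow 2))).add
        ((((hq' x hx).const_mul 4).mul (dN x hx)).mul (dP x hx))).congr_deriv ?_
      simp only [Pi.mul_apply, Pi.pow_apply]
      ring
  have hPR : P R = 0 := by simp only [hPdef, hP, mul_zero]
  have hSR : S R = 0 := by simp only [hSdef, hNdef, hS, sub_self, mul_zero]
  have hER : E R = 0 := by simp only [hEdef, hPR, hSR]; ring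
  have contP : ∀ x, 0 < x → ContinuousAt P x := fun x hx => (dP x hx).continuousAt
  -- `P` is negative just to the left of `R`
  obtain ⟨δ, hδ0, hδR, hδ⟩ : ∃ δ, 0 < δ ∧ δ < R ∧ ∀ x ∈ Ico δ R, P x < 0 := by
    have hneg : -(4 * q R * P R + 2 * q' R * N R) < 0 := by
      rw [hPR]
      have := mul_pos (hq1 R hR) (hN R hR)
      simp only [hNdef]; linarith
    have hSpos : ∀ᶠ x in 𝓝[<] R, 0 < S x := by
      have h1 := (dS R hR).tendsto_slope
      have h2 := (h1.mono_left (nhdsWithin_mono R (fun x (hx : x < R) => hx.ne))).eventually_lt_const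
        hneg
      filter_upwards [h2, self_mem_nhdsWithin] with x hx hxR
      have hxR' : x - R < 0 := sub_neg.mpr hxR
      rw [slope_def_field, hSR, sub_zero, div_lt_iff_of_neg hxR', zero_mul] at hx
      exact hx
    obtain ⟨l, hlR, hl⟩ := mem_nhdsLT_iff_exists_Ioo_subset.mp hSpos
    refine ⟨max ((l + R) / 2) (R / 2), by positivity, ?_, fun x hx => ?_⟩
    · exact max_lt (by linarith [mem_Iio.mp hlR]) (by linarith)
    have hlx : l < x := by
      have := (le_max_left _ _).trans hx.1
      linarith [mem_Iio.mp hlR]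
    have hx0 : 0 < x := by
      have := (le_max_right _ _).trans hx.1
      linarith
    have hmono : StrictMonoOn P (Icc x R) := by
      refine strictMonoOn_of_deriv_pos (convex_Icc x R)
        (fun t ht => (contP t (hx0.trans_le ht.1)).continuousWithinAt) fun t ht => ?_
      rw [interior_Icc] at ht
      rw [(dP t (hx0.trans ht.1)).deriv]
      exact hl ⟨hlx.trans ht.1, ht.2⟩
    have := hmono ⟨le_rfl, hx.2.le⟩ ⟨hx.2.le, le_rfl⟩ hx.2
    rwa [hPR] at this
  -- hence on all of `(0, R)`, by the energy identity
  have hPneg : ∀ x, 0 < x → x < R → P x < 0 := by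
    intro x hx hxR
    by_contra! hPx
    -- The bound `t ≤ δ` keeps `R`, itself a zero of `P`, out of the set, so that its supremum lies
    -- strictly to the left of `R`.
    set Z := {t | t ∈ Icc x R ∧ 0 ≤ P t ∧ t ≤ δ} with hZ
    have hxδ : x ≤ δ := by
      by_contra! hlt
      exact absurd (hδ x ⟨hlt.le, hxR⟩) (not_lt.mpr hPx)
    have hZne : Z.Nonempty := ⟨x, ⟨le_rfl, hxR.le⟩, hPx, hxδ⟩
    have hZbdd : BddAbove Z := ⟨δ, fun t ht => ht.2.2⟩
    have hZclosed : IsClosed Z := by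
      have h1 : ContinuousOn P (Icc x R) := fun t ht =>
        (contP t (hx.trans_le ht.1)).continuousWithinAt
      have h2 : Z = (Icc x R ∩ P ⁻¹' (Ici 0)) ∩ Iic δ := by
        ext t; simp [hZ, and_assoc]
      rw [h2]
      exact (h1.preimage_isClosed_of_isClosed isClosed_Icc isClosed_Ici).inter isClosed_Iic
    set s := sSup Z with hs
    obtain ⟨hs1, hs2, hs3⟩ := hZclosed.csSup_mem hZne hZbdd
    have hs0 : 0 < s := hx.trans_le hs1.1
    have hneg : ∀ t ∈ Ioo s R, P t < 0 := fun t ht => by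
      by_contra! hge
      rcases le_or_gt t δ with htδ | htδ
      · exact absurd (le_csSup hZbdd ⟨⟨hs1.1.trans ht.1.le, ht.2.le⟩, hge, htδ⟩) (not_le.mpr ht.1)
      · exact absurd (hδ t ⟨htδ.le, ht.2⟩) (not_lt.mpr hge)
    have hsR : s < R := hs3.trans_lt hδR
    have hmono : StrictMonoOn E (Icc s R) := by
      refine strictMonoOn_of_deriv_pos (convex_Icc s R)
        (fun t ht => (dE t (hs0.trans_le ht.1)).continuousAt.continuousWithinAt) fun t ht => ?_
      rw [interior_Icc] at ht
      have ht0 := hs0.trans ht.1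
      rw [(dE t ht0).deriv]
      have h1 := hneg t ht
      have h2 := mul_neg_of_pos_of_neg (hq1 t ht0) h1
      have h3 := mul_neg_of_neg_of_pos (hq2 t ht0) (hN t ht0)
      refine mul_pos_of_neg_of_neg (by linarith) ?_
      simp only [hNdef]
      linarith
    have hPs : P s = 0 := by
      refine le_antisymm ?_ hs2
      refine le_of_tendsto ((contP s hs0).continuousWithinAt (s := Ioi s)) ?_
      filter_upwards [Ioo_mem_nhdsGT hsR] with t ht using (hneg t ht).le
    have hlt := hmono ⟨le_rfl, hsR.le⟩ ⟨hsR.le, le_rfl⟩ hsR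
    rw [hER] at hlt
    have : E s = S s ^ 2 := by simp only [hEdef, hPs]; ring
    rw [this] at hlt
    exact absurd hlt (not_lt.mpr (sq_nonneg _))
  refine antitoneOn_of_deriv_nonpos (convex_Ioc 0 R)
    (fun t ht => (dN t ht.1).continuousAt.continuousWithinAt) (fun t ht => ?_) fun t ht => ?_
  · rw [interior_Ioc] at ht
    exact (dN t ht.1).differentiableAt.differentiableWithinAt
  · rw [interior_Ioc] at ht
    rw [(dN t ht.1).deriv]
    exact (hPneg t ht.1 ht.2).le

/-- The pair is not itself critical at a finite point, but it is a limit of such pairs. For large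
`R`, the solutions with data `(W, 0)` and `(0, √(q R) W)` at `R` make the sum of squares critical to
second order there. As `R → ∞` their sum of squares tends to `W (u₁² + u₂²)`, and monotonicity
passes to the limit. -/
theorem IsPhasePair.antitoneOn_sq_add_sq {q q' q'' u₁ u₂ v₁ v₂ : ℝ → ℝ} {W : ℝ}
    (h : IsPhasePair q u₁ u₂ v₁ v₂ W) (hW : 0 < W) (hqlim : Tendsto q atTop (𝓝 1))
    (hq : ∀ x, 0 < x → HasDerivAt q (q' x) x) (hq' : ∀ x, 0 < x → HasDerivAt q' (q'' x) x)
    (hq1 : ∀ x, 0 < x → 0 < q' x) (hq2 : ∀ x, 0 < x → q'' x < 0) :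
    AntitoneOn (fun x => u₁ x ^ 2 + u₂ x ^ 2) (Ioi 0) := by
  intro x hx y hy hxy
  have hx0 : 0 < x := hx
  have hy0 : 0 < y := hy
  set N : ℝ → ℝ → ℝ := fun R t => (v₂ R * u₁ t - v₁ R * u₂ t) ^ 2 +
    (√(q R) * u₁ R * u₂ t - √(q R) * u₂ R * u₁ t) ^ 2 with hN
  have hsq : ∀ᶠ R in atTop, √(q R) ^ 2 = q R := by
    filter_upwards [hqlim.eventually_const_lt one_pos] with R hR using Real.sq_sqrt hR.le
  have hlim : ∀ t, Tendsto (fun R => N R t) atTop (𝓝 (W * (u₁ t ^ 2 + u₂ t ^ 2))) := fun t => by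
    have t1 := (((h.tendsto_energy_snd hqlim).const_mul (u₁ t ^ 2)).add
      ((h.tendsto_energy_fst hqlim).const_mul (u₂ t ^ 2))).sub
      ((h.tendsto_energy_cross hqlim).const_mul (2 * u₁ t * u₂ t))
    have e : u₁ t ^ 2 * W + u₂ t ^ 2 * W - 2 * u₁ t * u₂ t * 0 = W * (u₁ t ^ 2 + u₂ t ^ 2) := by
      ring
    rw [e] at t1
    refine t1.congr' ?_
    filter_upwards [hsq] with R hR
    simp only [hN]
    linear_combination -(u₁ R * u₂ t - u₂ R * u₁ t) ^ 2 * hR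
  have hle : ∀ᶠ R in atTop, N R y ≤ N R x := by
    filter_upwards [hsq, eventually_ge_atTop y, hqlim.eventually_const_lt one_pos] with R hR hyR hqR
    have hR0 : 0 < R := hy0.trans_le hyR
    have hw := h.wronskian_eq hR0
    refine antitoneOn_sq_add_sq_of_critical
      (u₁ := fun t => v₂ R * u₁ t - v₁ R * u₂ t)
      (u₂ := fun t => √(q R) * u₁ R * u₂ t - √(q R) * u₂ R * u₁ t)
      (v₁ := fun t => v₂ R * v₁ t - v₁ R * v₂ t)
      (v₂ := fun t => √(q R) * u₁ R * v₂ t - √(q R) * u₂ R * v₁ t)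
      hq hq' hq1 hq2 (fun t ht => ?_) (fun t ht => ?_) (fun t ht => ?_) (fun t ht => ?_) hR0
      (fun t ht => ?_) ?_ ?_ ⟨hx0, hxy.trans hyR⟩ ⟨hy0, hyR⟩ hxy
    · exact ((h.deriv_fst t ht).const_mul _).sub ((h.deriv_snd t ht).const_mul _)
    · exact ((h.deriv_snd t ht).const_mul _).sub ((h.deriv_fst t ht).const_mul _)
    · refine (((h.deriv_deriv_fst t ht).const_mul _).sub
        ((h.deriv_deriv_snd t ht).const_mul _)).congr_deriv ?_
      ring
    · refine (((h.deriv_deriv_snd t ht).const_mul _).sub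
        ((h.deriv_deriv_fst t ht).const_mul _)).congr_deriv ?_
      ring
    · by_contra! hle
      have hs : 0 < √(q R) := Real.sqrt_pos.mpr hqR
      have z1 : v₂ R * u₁ t - v₁ R * u₂ t = 0 := by nlinarith
      have z2 : √(q R) * u₁ R * u₂ t - √(q R) * u₂ R * u₁ t = 0 := by nlinarith
      have z3 : u₁ R * u₂ t - u₂ R * u₁ t = 0 := by
        refine mul_left_cancel₀ hs.ne' ?_
        rw [mul_zero]; linarith
      have w1 : W * u₁ t = 0 := by rw [← hw]; linear_combination u₁ R * z1 + v₁ R * z3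
      have w2 : W * u₂ t = 0 := by rw [← hw]; linear_combination u₂ R * z1 + v₂ R * z3
      have w3 := h.wronskian_eq ht
      rw [(mul_eq_zero.mp w1).resolve_left hW.ne', (mul_eq_zero.mp w2).resolve_left hW.ne'] at w3
      linarith
    · ring
    · linear_combination (u₁ R * v₂ R - u₂ R * v₁ R) ^ 2 * hR
  have := le_of_tendsto_of_tendsto (hlim y) (hlim x) hle
  exact le_of_mul_le_mul_left this hW

/-! ### The turning point `x = α`: steepest descent for `sinh w - w` -/

theorem cos_le_one_sub_sq_add {x : ℝ} (hx : 0 ≤ x) (hx' : x ≤ 4) :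
    Real.cos x ≤ 1 - x ^ 2 / 2 + x ^ 4 / 24 := by
  have h1 := Real.sin_ge_sub_cube (by linarith : 0 ≤ x / 2)
  have h2 : Real.cos x = 1 - 2 * Real.sin (x / 2) ^ 2 := by
    have h := Real.cos_sq' (x / 2)
    have h' := Real.cos_two_mul (x / 2)
    rw [mul_div_cancel₀ x two_ne_zero] at h'
    linarith
  have h3 : 0 ≤ x / 2 - (x / 2) ^ 3 / 6 := by
    have : x / 2 - (x / 2) ^ 3 / 6 = x / 2 * (1 - (x / 2) ^ 2 / 6) := by ring
    rw [this]
    exact mul_nonneg (by linarith) (by nlinarith)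
  have h4 : (x / 2 - (x / 2) ^ 3 / 6) ^ 2 ≤ Real.sin (x / 2) ^ 2 := pow_le_pow_left₀ h3 h1 2
  have h5 : 0 ≤ x ^ 6 := by positivity
  nlinarith

/-- `v / sin v` is the hyperbolic cosine of the real part at height `v` of the path of steepest
descent from `0` for `sinh w - w`. -/
theorem one_lt_div_sin {v : ℝ} (h0 : 0 < v) (hπ : v < Real.pi) : 1 < v / Real.sin v := by
  rw [one_lt_div (Real.sin_pos_of_pos_of_lt_pi h0 hπ)]
  exact Real.sin_lt h0

/-- With `ρ = sin v * turnSinh v` this says that the descent path has horizontal slope at least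
`1/3`. The slope tends to `1/√3` at `v = 0`, so crude Taylor bounds suffice up to `π/2`, and the
sign of the cosine helps beyond. -/
theorem sin_mul_sqrt_le {v ρ : ℝ} (h0 : 0 < v) (hπ : v < Real.pi) (hρ : 0 ≤ ρ)
    (hρ2 : ρ ^ 2 = v ^ 2 - Real.sin v ^ 2) :
    Real.sin v * ρ ≤ 3 * (Real.sin v - v * Real.cos v) := by
  have hs := Real.sin_pos_of_pos_of_lt_pi h0 hπ
  have hπ1 := Real.pi_lt_d2
  have hπ2 := Real.pi_gt_d2
  have hsv : Real.sin v ≤ v := Real.sin_le h0.le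
  rcases le_or_gt v (Real.pi / 2) with hv | hv
  · have h1 := Real.sin_ge_sub_cube h0.le
    have h2 := cos_le_one_sub_sq_add h0.le (by linarith)
    have hv2 : v ^ 2 ≤ 5 / 2 := by nlinarith
    have h3 : 0 ≤ v - v ^ 3 / 6 := by
      have : v - v ^ 3 / 6 = v * (1 - v ^ 2 / 6) := by ring
      rw [this]
      exact mul_nonneg h0.le (by linarith)
    have h4 := pow_le_pow_left₀ h3 h1 2
    have h5 : ρ ^ 2 ≤ v ^ 4 / 3 := by
      have : 0 ≤ v ^ 6 := by positivity
      nlinarith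
    have h6 : ρ ≤ 0.58 * v ^ 2 := by
      refine abs_le_of_sq_le_sq' ?_ (by positivity) |>.2
      have : 0 ≤ v ^ 4 := by positivity
      nlinarith
    have h7 : 0.2 * v ^ 3 ≤ Real.sin v - v * Real.cos v := by
      have h8 := mul_le_mul_of_nonneg_left h2 h0.le
      have h9 : 0 ≤ v ^ 3 := by positivity
      nlinarith
    calc Real.sin v * ρ ≤ v * (0.58 * v ^ 2) := by gcongr
      _ ≤ 3 * (0.2 * v ^ 3) := by
        have h9 : 0 ≤ v ^ 3 := by positivity
        nlinarith
      _ ≤ _ := by linarith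
  · have hρv : ρ ≤ v := abs_le_of_sq_le_sq' (by rw [hρ2]; nlinarith) h0.le |>.2
    have hc : Real.cos v ≤ 0 :=
      Real.cos_nonpos_of_pi_div_two_le_of_le hv.le (by linarith)
    have h1 : Real.sin v * ρ ≤ Real.sin v * v := by gcongr
    rcases le_or_gt v 3 with hv3 | hv3
    · nlinarith
    · have h2 := Real.one_sub_sq_div_two_le_cos (x := Real.pi - v)
      rw [Real.cos_pi_sub] at h2
      have h3 : Real.cos v ≤ -(1 / 2) := by nlinarith
      have h4 := Real.sin_le_one v
      nlinarith

/-- The derivative form of the comparison of `turnRate v` with `sinh (2v/3) - 2v/3`. To leading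
order at `0` the factor `2/√3` would be admissible in place of `2/3`, which leaves ample room. -/
theorem two_thirds_cosh_sub_one_le {v : ℝ} (h0 : 0 < v) (hπ : v < Real.pi) :
    2 / 3 * (Real.cosh (2 / 3 * v) - 1) ≤ v / Real.sin v - Real.cos v := by
  have hs := Real.sin_pos_of_pos_of_lt_pi h0 hπ
  have hπ1 := Real.pi_lt_d2
  have hπ2 := Real.pi_gt_d2
  rcases le_or_gt v (Real.pi / 2) with hv | hv
  · have h1 := one_lt_div_sin h0 hπ
    have h2 := cos_le_one_sub_sq_add h0.le (by linarith)
    have hv2 : v ^ 2 ≤ 5 / 2 := by nlinarith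
    have h3 := Real.cosh_le_exp_half_sq (2 / 3 * v)
    have h4 : Real.exp ((2 / 3 * v) ^ 2 / 2) ≤ 1 / (1 - (2 / 3 * v) ^ 2 / 2) :=
      Real.exp_bound_div_one_sub_of_interval (by positivity) (by nlinarith)
    have h5 : 1 / (1 - (2 / 3 * v) ^ 2 / 2) ≤ 1 + v ^ 2 / 2 := by
      rw [div_le_iff₀ (by nlinarith)]
      nlinarith [sq_nonneg v]
    nlinarith [sq_nonneg v]
  · have hc : Real.cos v ≤ 0 :=
      Real.cos_nonpos_of_pi_div_two_le_of_le hv.le (by linarith)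
    have h1 : v ≤ v / Real.sin v := by
      rw [le_div_iff₀ hs]
      exact mul_le_of_le_one_right h0.le (Real.sin_le_one v)
    have h2 : Real.cosh (2 / 3 * v) ≤ (Real.exp (2 / 3 * v) + 1) / 2 := by
      rw [Real.cosh_eq]
      have : Real.exp (-(2 / 3 * v)) ≤ 1 := Real.exp_le_one_iff.mpr (by linarith)
      linarith
    have he := Real.exp_one_lt_d9
    have he0 := Real.exp_pos 1
    have he2 : Real.exp 2 ≤ 7.39 := by
      have : Real.exp 2 = Real.exp 1 * Real.exp 1 := by rw [← Real.exp_add]; norm_num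
      rw [this]; nlinarith
    rcases le_or_gt v (5 / 2) with hv3 | hv3
    · have h3 : Real.exp (2 / 3 * v) ≤ Real.exp 2 * Real.exp (-(1 / 3)) := by
        rw [← Real.exp_add]; exact Real.exp_le_exp.mpr (by linarith)
      have h4 : Real.exp (-(1 / 3)) ≤ 3 / 4 := by
        rw [Real.exp_neg, inv_le_comm₀ (Real.exp_pos _) (by norm_num)]
        have := Real.add_one_le_exp (1 / 3 : ℝ)
        linarith
      have h5 : Real.exp 2 * Real.exp (-(1 / 3)) ≤ 7.39 * (3 / 4) := by gcongr
      linarith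
    · have h3 : Real.exp (2 / 3 * v) ≤ Real.exp 2 * Real.exp (1 / 10) := by
        rw [← Real.exp_add]; exact Real.exp_le_exp.mpr (by linarith)
      have h4 : Real.exp (1 / 10) ≤ 1 / (1 - 1 / 10) :=
        Real.exp_bound_div_one_sub_of_interval (by norm_num) (by norm_num)
      have h5 : Real.exp 2 * Real.exp (1 / 10) ≤ 7.39 * (1 / (1 - 1 / 10)) := by gcongr
      linarith

/-- Real part, at height `v`, of the path of steepest descent from `0` for `sinh w - w`. -/
noncomputable def turnRe (v : ℝ) : ℝ := Real.arcosh (v / Real.sin v)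

/-- Hyperbolic sine of `turnRe v`. -/
noncomputable def turnSinh (v : ℝ) : ℝ := √((v / Real.sin v) ^ 2 - 1)

/-- Decay of the kernel along the path of steepest descent from `0` for `sinh w - w`. -/
noncomputable def turnRate (v : ℝ) : ℝ := turnRe v - turnSinh v * Real.cos v

section Turn

variable {v : ℝ}

theorem turnSinh_pos (h0 : 0 < v) (hπ : v < Real.pi) : 0 < turnSinh v := by
  have := one_lt_div_sin h0 hπ
  exact Real.sqrt_pos.mpr (by nlinarith)

theorem turnSinh_sq (h0 : 0 < v) (hπ : v < Real.pi) :
    turnSinh v ^ 2 = (v / Real.sin v) ^ 2 - 1 := by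
  have := one_lt_div_sin h0 hπ
  exact Real.sq_sqrt (by nlinarith)

theorem hasDerivAt_div_sin (h0 : 0 < v) (hπ : v < Real.pi) :
    HasDerivAt (fun v => v / Real.sin v)
      ((Real.sin v - v * Real.cos v) / Real.sin v ^ 2) v := by
  have hs := Real.sin_pos_of_pos_of_lt_pi h0 hπ
  refine ((hasDerivAt_id v).div (Real.hasDerivAt_sin v) hs.ne').congr_deriv ?_
  simp

theorem hasDerivAt_turnRe (h0 : 0 < v) (hπ : v < Real.pi) :
    HasDerivAt turnRe
      ((Real.sin v - v * Real.cos v) / (Real.sin v ^ 2 * turnSinh v)) v := by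
  refine ((Real.hasDerivAt_arcosh (one_lt_div_sin h0 hπ)).comp v
    (hasDerivAt_div_sin h0 hπ)).congr_deriv ?_
  rw [turnSinh]
  field_simp

theorem hasDerivAt_turnSinh (h0 : 0 < v) (hπ : v < Real.pi) :
    HasDerivAt turnSinh
      (v * (Real.sin v - v * Real.cos v) / (Real.sin v ^ 3 * turnSinh v)) v := by
  have h1 := ((hasDerivAt_div_sin h0 hπ).pow 2).sub_const 1
  have hne : (v / Real.sin v) ^ 2 - 1 ≠ 0 := by
    rw [← turnSinh_sq h0 hπ]; exact (pow_pos (turnSinh_pos h0 hπ) 2).ne'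
  refine (h1.sqrt hne).congr_deriv ?_
  have hs := (Real.sin_pos_of_pos_of_lt_pi h0 hπ).ne'
  have h2 := (turnSinh_pos h0 hπ).ne'
  simp only [Pi.pow_apply, Nat.cast_ofNat, Nat.reduceSub, pow_one]
  rw [← turnSinh]
  field_simp

theorem one_third_le_deriv_turnRe (h0 : 0 < v) (hπ : v < Real.pi) :
    1 / 3 ≤ (Real.sin v - v * Real.cos v) / (Real.sin v ^ 2 * turnSinh v) := by
  have hs := Real.sin_pos_of_pos_of_lt_pi h0 hπ
  have h2 := turnSinh_pos h0 hπ
  have h := sin_mul_sqrt_le h0 hπ (ρ := Real.sin v * turnSinh v) (by positivity) (by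
    rw [mul_pow, turnSinh_sq h0 hπ]; field_simp)
  rw [le_div_iff₀ (by positivity)]
  nlinarith

theorem hasDerivAt_turnRate (h0 : 0 < v) (hπ : v < Real.pi) :
    HasDerivAt turnRate ((v - Real.sin v * Real.cos v) ^ 2 / (Real.sin v ^ 3 * turnSinh v)) v := by
  refine ((hasDerivAt_turnRe h0 hπ).sub ((hasDerivAt_turnSinh h0 hπ).mul
    (Real.hasDerivAt_cos v))).congr_deriv ?_
  have hs := (Real.sin_pos_of_pos_of_lt_pi h0 hπ).ne'
  have h2 := (turnSinh_pos h0 hπ).ne'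
  have h3 := turnSinh_sq h0 hπ
  have h4 := Real.cos_sq' v
  field_simp at h3 ⊢
  linear_combination Real.sin v ^ 2 * h3 + (v ^ 2 - Real.sin v ^ 2) * h4

/-- The identity `(sin² v · turnSinh v)² + (sin v - v cos v)² = (v - sin v cos v)²` allows one
factor of the numerator to be replaced by `sin² v · turnSinh v`. -/
theorem sub_div_sin_le_deriv_turnRate (h0 : 0 < v) (hπ : v < Real.pi) :
    v / Real.sin v - Real.cos v ≤
      (v - Real.sin v * Real.cos v) ^ 2 / (Real.sin v ^ 3 * turnSinh v) := by
  have hs := Real.sin_pos_of_pos_of_lt_pi h0 hπ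
  have h2 := turnSinh_pos h0 hπ
  have h3 := turnSinh_sq h0 hπ
  have h4 := Real.cos_sq' v
  have h5 : 0 ≤ v - Real.sin v * Real.cos v := by
    have h6 := Real.sin_lt h0
    have h7 := Real.cos_le_one v
    nlinarith
  have h6 : Real.sin v ^ 2 * turnSinh v ≤ v - Real.sin v * Real.cos v := by
    refine abs_le_of_sq_le_sq' ?_ h5 |>.2
    have h7 : (Real.sin v ^ 2 * turnSinh v) ^ 2 + (Real.sin v - v * Real.cos v) ^ 2 =
        (v - Real.sin v * Real.cos v) ^ 2 := by
      field_simp at h3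
      linear_combination Real.sin v ^ 2 * h3 + (v ^ 2 - Real.sin v ^ 2) * h4
    nlinarith [sq_nonneg (Real.sin v - v * Real.cos v)]
  rw [le_div_iff₀ (by positivity)]
  calc (v / Real.sin v - Real.cos v) * (Real.sin v ^ 3 * turnSinh v)
      = (v - Real.sin v * Real.cos v) * (Real.sin v ^ 2 * turnSinh v) := by field_simp
    _ ≤ (v - Real.sin v * Real.cos v) * (v - Real.sin v * Real.cos v) :=
        mul_le_mul_of_nonneg_left h6 h5
    _ = _ := by ring

end Turn

theorem tendsto_div_sin_zero : Tendsto (fun v => v / Real.sin v) (𝓝[>] 0) (𝓝 1) := by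
  have h := (Real.continuous_sinc.tendsto 0).inv₀ (by simp)
  rw [Real.sinc_zero, inv_one] at h
  refine (h.mono_left nhdsWithin_le_nhds).congr' ?_
  filter_upwards [self_mem_nhdsWithin] with v hv
  rw [Real.sinc_of_ne_zero (ne_of_gt hv), inv_div]

theorem tendsto_turnRe_zero : Tendsto turnRe (𝓝[>] 0) (𝓝 0) := by
  have h1 : Tendsto (fun v => v / Real.sin v) (𝓝[>] 0) (𝓝[Ici 1] 1) := by
    refine tendsto_nhdsWithin_iff.mpr ⟨tendsto_div_sin_zero, ?_⟩
    filter_upwards [Ioo_mem_nhdsGT Real.pi_pos] with v hv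
    exact (one_lt_div_sin hv.1 hv.2).le
  have h2 := (Real.continuousOn_arcosh 1 (mem_Ici.mpr le_rfl)).tendsto.comp h1
  rwa [Real.arcosh_zero] at h2

theorem tendsto_turnSinh_zero : Tendsto turnSinh (𝓝[>] 0) (𝓝 0) := by
  have h : Tendsto turnSinh (𝓝[>] 0) (𝓝 √(1 ^ 2 - 1)) :=
    (Real.continuous_sqrt.tendsto _).comp ((tendsto_div_sin_zero.pow 2).sub_const 1)
  simpa using h

theorem tendsto_turnRe_pi : Tendsto turnRe (𝓝[<] Real.pi) atTop := by
  have h1 : Tendsto (fun v => v / Real.sin v) (𝓝[<] Real.pi) atTop := by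
    have hs : Tendsto Real.sin (𝓝[<] Real.pi) (𝓝[>] 0) := by
      refine tendsto_nhdsWithin_iff.mpr ⟨?_, ?_⟩
      · have := Real.continuous_sin.tendsto Real.pi
        rw [Real.sin_pi] at this
        exact this.mono_left nhdsWithin_le_nhds
      · filter_upwards [Ioo_mem_nhdsLT Real.pi_pos] with v hv
        exact Real.sin_pos_of_pos_of_lt_pi hv.1 hv.2
    have hv : Tendsto (fun v : ℝ => v) (𝓝[<] Real.pi) (𝓝 Real.pi) :=
      tendsto_id.mono_left nhdsWithin_le_nhds
    exact (hv.pos_mul_atTop Real.pi_pos (tendsto_inv_nhdsGT_zero.comp hs))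
  refine tendsto_atTop_mono' _ ?_ (Real.tendsto_log_atTop.comp h1)
  filter_upwards [Ioo_mem_nhdsLT Real.pi_pos] with v hv
  have h2 := one_lt_div_sin hv.1 hv.2
  rw [Function.comp, turnRe, ← Real.exp_le_exp, Real.exp_log (by linarith),
    Real.exp_arcosh h2.le]
  linarith [Real.sqrt_nonneg ((v / Real.sin v) ^ 2 - 1)]

theorem le_of_hasDerivAt_nonneg_of_tendsto {f f' : ℝ → ℝ} {a b l : ℝ}
    (hf : ∀ v ∈ Ioo a b, HasDerivAt f (f' v) v) (hf' : ∀ v ∈ Ioo a b, 0 ≤ f' v)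
    (hl : Tendsto f (𝓝[>] a) (𝓝 l)) {v : ℝ} (hv : v ∈ Ioo a b) : l ≤ f v := by
  have hmono : MonotoneOn f (Ioo a b) := by
    refine monotoneOn_of_deriv_nonneg (convex_Ioo a b)
      (fun t ht => (hf t ht).continuousAt.continuousWithinAt) (fun t ht => ?_) fun t ht => ?_
    · rw [interior_Ioo] at ht
      exact (hf t ht).differentiableAt.differentiableWithinAt
    · rw [interior_Ioo] at ht
      rw [(hf t ht).deriv]
      exact hf' t ht
  refine le_of_tendsto hl ?_
  filter_upwards [Ioo_mem_nhdsGT hv.1] with t ht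
  exact hmono ⟨ht.1, ht.2.trans hv.2⟩ hv ht.2.le

theorem sinh_sub_le_turnRate {v : ℝ} (h0 : 0 < v) (hπ : v < Real.pi) :
    Real.sinh (2 / 3 * v) - 2 / 3 * v ≤ turnRate v := by
  have hlim : Tendsto (fun v => turnRate v - (Real.sinh (2 / 3 * v) - 2 / 3 * v)) (𝓝[>] 0)
      (𝓝 0) := by
    have h1 : Tendsto (fun v : ℝ => Real.sinh (2 / 3 * v) - 2 / 3 * v) (𝓝[>] 0) (𝓝 0) := by
      have hc : Continuous fun v : ℝ => Real.sinh (2 / 3 * v) - 2 / 3 * v := by fun_prop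
      simpa using (hc.tendsto 0).mono_left nhdsWithin_le_nhds
    have h2 : Tendsto Real.cos (𝓝[>] 0) (𝓝 1) := by
      simpa using (Real.continuous_cos.tendsto 0).mono_left nhdsWithin_le_nhds
    simpa [turnRate] using (tendsto_turnRe_zero.sub (tendsto_turnSinh_zero.mul h2)).sub h1
  have h := le_of_hasDerivAt_nonneg_of_tendsto
    (f' := fun v => (v - Real.sin v * Real.cos v) ^ 2 / (Real.sin v ^ 3 * turnSinh v) -
      2 / 3 * (Real.cosh (2 / 3 * v) - 1)) (fun t ht => ?_) (fun t ht => ?_) hlim ⟨h0, hπ⟩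
  · linarith
  · have h1 : HasDerivAt (fun v : ℝ => 2 / 3 * v) (2 / 3) t := by
      simpa using (hasDerivAt_id t).const_mul (2 / 3)
    refine ((hasDerivAt_turnRate ht.1 ht.2).sub (h1.sinh.sub h1)).congr_deriv ?_
    ring
  · have h1 := sub_div_sin_le_deriv_turnRate ht.1 ht.2
    have h2 := two_thirds_cosh_sub_one_le ht.1 ht.2
    linarith

/-- The relation `cosh (turnRe v) = v / sin v` makes `Im (sinh w - w)` vanish, so the kernel is real
on the path. Hence the real and imaginary parts of the contour integral separate into integrals
against `d(turnRe v)` and `dv`. -/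
theorem hankelKernel_turn (α : ℝ) {v : ℝ} (h0 : 0 < v) (hπ : v < Real.pi) :
    hankelKernel α α (turnRe v + v * Complex.I) = ((Real.exp (-(α * turnRate v)) : ℝ) : ℂ) := by
  have h1 := one_lt_div_sin h0 hπ
  have hs := (Real.sin_pos_of_pos_of_lt_pi h0 hπ).ne'
  have e : Complex.sinh (turnRe v + v * Complex.I) =
      ((turnSinh v * Real.cos v : ℝ) : ℂ) + v * Complex.I := by
    rw [Complex.sinh_add, Complex.sinh_mul_I, Complex.cosh_mul_I, ← Complex.ofReal_sinh,
      ← Complex.ofReal_cosh, ← Complex.ofReal_cos, ← Complex.ofReal_sin, turnRe,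
      Real.sinh_arcosh h1.le, Real.cosh_arcosh h1.le, ← turnSinh, ← mul_assoc,
      ← Complex.ofReal_mul, ← Complex.ofReal_mul, div_mul_cancel₀ _ hs]
  rw [hankelKernel, e, Complex.ofReal_exp, turnRate]
  congr 1
  push_cast; ring

/-- At `x = α` the sum `J_α + Y_α` is nonpositive. -/
theorem besselJ_add_besselY_self_nonpos {α : ℝ} (hα : 0 < α) :
    besselJ α α + besselY α α ≤ 0 := by
  obtain ⟨F, hF⟩ := exists_primitive_hankelKernel α α
  set Φ : ℝ → ℂ := fun v => F (turnRe v + v * Complex.I) with hΦ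
  set D : ℝ → ℝ := fun v =>
    (Real.sin v - v * Real.cos v) / (Real.sin v ^ 2 * turnSinh v) with hD
  set e : ℝ → ℝ := fun v => Real.exp (-(α * turnRate v)) with he
  have dΦ : ∀ v ∈ Ioo 0 Real.pi, HasDerivAt Φ ((e v : ℂ) * (D v + 1 * Complex.I)) v :=
    fun v hv => by
      have h1 : HasDerivAt (fun v : ℝ => (turnRe v : ℂ) + v * Complex.I)
          (D v + 1 * Complex.I) v :=
        (hasDerivAt_turnRe hv.1 hv.2).ofReal_comp.add
          ((Complex.ofRealCLM.hasDerivAt).mul_const _)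
      exact ((hF _).comp v h1).congr_deriv (by rw [hankelKernel_turn α hv.1 hv.2])
  have dre : ∀ v ∈ Ioo 0 Real.pi, HasDerivAt (fun v => (Φ v).re) (e v * D v) v := fun v hv =>
    (Complex.reCLM.hasFDerivAt.comp_hasDerivAt v (dΦ v hv)).congr_deriv (by
      simp [Complex.reCLM_apply])
  have dim : ∀ v ∈ Ioo 0 Real.pi, HasDerivAt (fun v => (Φ v).im) (e v) v := fun v hv =>
    (Complex.imCLM.hasFDerivAt.comp_hasDerivAt v (dΦ v hv)).congr_deriv (by
      simp [Complex.imCLM_apply])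
  have hF0 : Tendsto Φ (𝓝[>] 0) (𝓝 (F 0)) := by
    have h1 : Tendsto (fun v : ℝ => (turnRe v : ℂ) + v * Complex.I) (𝓝[>] 0) (𝓝 0) := by
      have h2 : Tendsto (fun v : ℝ => (v : ℂ) * Complex.I) (𝓝[>] 0) (𝓝 0) := by
        have hc : Continuous fun v : ℝ => (v : ℂ) * Complex.I := by fun_prop
        simpa using (hc.tendsto 0).mono_left nhdsWithin_le_nhds
      have h3 := (Complex.continuous_ofReal.tendsto 0).comp tendsto_turnRe_zero
      simpa [Function.comp_def] using h3.add h2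
    exact (hF 0).continuousAt.tendsto.comp h1
  have hFπ : Tendsto Φ (𝓝[<] Real.pi) (𝓝 (F 0 - schlafliExp α α - (Real.pi * besselY α α : ℝ) +
        (Real.pi * besselJ α α : ℝ) * Complex.I)) := by
    have h1 := (tendsto_primitive_add_pi_mul_I hα hF).comp tendsto_turnRe_pi
    have hb : Tendsto (fun v : ℝ => Real.exp 0 * (Real.pi - v)) (𝓝[<] Real.pi) (𝓝 0) := by
      have hc : Continuous fun v : ℝ => Real.exp 0 * (Real.pi - v) := by fun_prop
      simpa using (hc.tendsto Real.pi).mono_left nhdsWithin_le_nhds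
    have h2 : Tendsto (fun v : ℝ => F (turnRe v + Real.pi * Complex.I) - Φ v) (𝓝[<] Real.pi)
        (𝓝 0) := by
      refine squeeze_zero_norm' ?_ hb
      filter_upwards [Ioo_mem_nhdsLT (half_lt_self Real.pi_pos)] with v hv
      have hv0 : 0 < v := (half_pos Real.pi_pos).trans hv.1
      refine norm_primitive_sub_vertical_le hF hv.2.le fun b hb => ?_
      have hU : 0 ≤ turnRe v := Real.arcosh_nonneg (one_lt_div_sin hv0 hv.2).le
      have h3 : Real.cos b ≤ 0 := Real.cos_nonpos_of_pi_div_two_le_of_le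
        (hv.1.le.trans hb.1) (by linarith [hb.2, Real.pi_pos])
      have h4 := mul_nonneg (mul_nonneg hα.le (Real.sinh_nonneg_iff.mpr hU)) (neg_nonneg.mpr h3)
      have h5 := mul_nonneg hα.le hU
      linarith
    simpa [Function.comp_def] using h1.sub h2
  have hre0 := (Complex.continuous_re.tendsto _).comp hF0
  have him0 := (Complex.continuous_im.tendsto _).comp hF0
  have hreπ := (Complex.continuous_re.tendsto _).comp hFπ
  have himπ := (Complex.continuous_im.tendsto _).comp hFπ
  have hmem : ∀ᶠ v in 𝓝[<] Real.pi, v ∈ Ioo 0 Real.pi := Ioo_mem_nhdsLT Real.pi_pos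
  -- The imaginary increment of `F` along the path is `π J`, the real one `-A - π Y` with `A =
  -- schlafliExp α α`. The slope bound gives `-A - π Y ≥ π J / 3`.
  have key1 : (F 0).re - 1 / 3 * (F 0).im ≤ _ :=
    ge_of_tendsto (hreπ.sub (himπ.const_mul (1 / 3))) (by
      filter_upwards [hmem] with v hv
      refine le_of_hasDerivAt_nonneg_of_tendsto (f := fun v => (Φ v).re - 1 / 3 * (Φ v).im)
        (f' := fun v => e v * D v - 1 / 3 * e v)
        (fun t ht => (dre t ht).sub ((dim t ht).const_mul _)) (fun t ht => ?_)
        (hre0.sub (him0.const_mul _)) hv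
      have h1 := one_third_le_deriv_turnRe ht.1 ht.2
      have h2 : 0 < e t := Real.exp_pos _
      simp only [hD]
      nlinarith)
  set g : ℝ → ℝ := fun u => Real.exp (-(α * Real.sinh u) + α * u) with hg
  have hgc : Continuous g := by fun_prop
  set G : ℝ → ℝ := fun t => ∫ u in (0 : ℝ)..t, g u with hG
  have dG : ∀ t, HasDerivAt G (g t) t := fun t =>
    (hgc.integral_hasStrictDerivAt 0 t).hasDerivAt
  have hGc : Continuous G := continuous_iff_continuousAt.mpr fun t => (dG t).continuousAt
  have hG0 : G 0 = 0 := intervalIntegral.integral_same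
  have hGA : ∀ t, 0 ≤ t → G t ≤ schlafliExp α α := fun t ht => by
    simp only [hG]
    rw [intervalIntegral.integral_of_le ht, schlafliExp]
    exact setIntegral_mono_set (integrableOn_schlafliExp α hα)
      (Eventually.of_forall fun u => (Real.exp_pos _).le)
      (Eventually.of_forall fun u hu => hu.1)
  have hGlim : Tendsto (fun v : ℝ => G (2 / 3 * v)) (𝓝[>] 0) (𝓝 0) := by
    have hc : Continuous fun v : ℝ => G (2 / 3 * v) := by fun_prop
    have := (hc.tendsto 0).mono_left (nhdsWithin_le_nhds (s := Ioi 0))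
    rwa [mul_zero, hG0] at this
  -- The substitution `u = 2v/3` in `A`, cut off at `u = 2π/3`, compares its integrand with that of
  -- `π J`. The constants `1/3` and `2/3` add up to `1`, so the two bounds together give `-π Y ≥ π
  -- J`.
  have key2 : Real.pi * besselJ α α * (2 / 3) ≤ schlafliExp α α := by
    have h1 : ∀ v ∈ Ioo 0 Real.pi, 0 - 2 / 3 * (F 0).im ≤ G (2 / 3 * v) - 2 / 3 * (Φ v).im :=
      fun v hv => by
        refine le_of_hasDerivAt_nonneg_of_tendsto
          (f' := fun v => g (2 / 3 * v) * (2 / 3) - 2 / 3 * e v)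
          (fun t ht => ?_) (fun t ht => ?_) (hGlim.sub (him0.const_mul (2 / 3))) hv
        · have h2 : HasDerivAt (fun v : ℝ => 2 / 3 * v) (2 / 3) t := by
            simpa using (hasDerivAt_id t).const_mul (2 / 3)
          exact ((dG _).comp t h2).sub ((dim t ht).const_mul _)
        · have h3 : e t ≤ g (2 / 3 * t) := by
            refine Real.exp_le_exp.mpr ?_
            have := mul_le_mul_of_nonneg_left (sinh_sub_le_turnRate ht.1 ht.2) hα.le
            linarith
          linarith
    have h2 : _ ≤ schlafliExp α α + 2 / 3 * (F 0).im := le_of_tendsto (himπ.const_mul (2 / 3)) (by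
      filter_upwards [hmem] with v hv
      have h3 := h1 v hv
      have h4 := hGA (2 / 3 * v) (by linarith [hv.1])
      simp only [Function.comp]
      linarith)
    simp at h2
    linarith
  simp at key1
  have hπ := Real.pi_pos
  have h5 : Real.pi * (besselJ α α + besselY α α) ≤ 0 := by linarith
  exact nonpos_of_mul_nonpos_right h5 hπ

/-! ### Bounds and monotonicity for `x (J² + Y²)` -/

theorem hasDerivAt_besselPotential (ν : ℝ) {x : ℝ} (hx : 0 < x) :
    HasDerivAt (besselPotential ν) (2 * (ν ^ 2 - 1 / 4) / x ^ 3) x := by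
  have h := (((hasDerivAt_pow 2 x).fun_inv (pow_ne_zero 2 hx.ne')).const_mul
    (ν ^ 2 - 1 / 4)).const_sub 1
  refine h.congr_deriv ?_
  field_simp
  ring

theorem hasDerivAt_deriv_besselPotential (ν : ℝ) {x : ℝ} (hx : 0 < x) :
    HasDerivAt (fun x => 2 * (ν ^ 2 - 1 / 4) / x ^ 3) (-(6 * (ν ^ 2 - 1 / 4) / x ^ 4)) x := by
  have h := ((hasDerivAt_pow 3 x).fun_inv (pow_ne_zero 3 hx.ne')).const_mul
    (2 * (ν ^ 2 - 1 / 4))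
  refine h.congr_deriv ?_
  field_simp
  ring

theorem tendsto_besselPotential (ν : ℝ) : Tendsto (besselPotential ν) atTop (𝓝 1) := by
  have h := ((tendsto_pow_atTop (α := ℝ) two_ne_zero).const_div_atTop (ν ^ 2 - 1 / 4)).const_sub 1
  rwa [sub_zero] at h

theorem sqrt_mul_sq_add_sq (ν : ℝ) {x : ℝ} (hx : 0 < x) :
    (√x * besselJ ν x) ^ 2 + (√x * besselY ν x) ^ 2 =
      x * (besselJ ν x ^ 2 + besselY ν x ^ 2) := by
  rw [mul_pow, mul_pow, Real.sq_sqrt hx.le]; ring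

theorem mul_besselJ_sq_add_besselY_sq_le {ν : ℝ} (hν : |ν| ≤ 1 / 2) {x : ℝ} (hx : 0 < x) :
    x * (besselJ ν x ^ 2 + besselY ν x ^ 2) ≤ 2 / Real.pi := by
  rw [← sqrt_mul_sq_add_sq ν hx]
  refine (isPhasePair_bessel ν).sq_add_sq_le (by positivity) (tendsto_besselPotential ν)
    (fun y hy => hasDerivAt_besselPotential ν hy) (fun y hy => ?_) hx
  have h : ν ^ 2 ≤ (1 / 2) ^ 2 := by rw [← sq_abs]; gcongr
  exact div_nonpos_of_nonpos_of_nonneg (by linarith) (by positivity)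

theorem antitoneOn_mul_besselJ_sq_add_besselY_sq {ν : ℝ} (hν : 1 / 2 < ν) :
    AntitoneOn (fun x => x * (besselJ ν x ^ 2 + besselY ν x ^ 2)) (Ioi 0) := by
  have hpos : 0 < ν ^ 2 - 1 / 4 := by nlinarith
  have h := (isPhasePair_bessel ν).antitoneOn_sq_add_sq (by positivity)
    (tendsto_besselPotential ν) (fun y hy => hasDerivAt_besselPotential ν hy)
    (fun y hy => hasDerivAt_deriv_besselPotential ν hy) (fun y hy => by positivity)
    (fun y hy => neg_lt_zero.mpr (by positivity))
  exact h.congr fun x hx => sqrt_mul_sq_add_sq ν hx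

theorem besselJ_wronskian (ν : ℝ) {x : ℝ} (hx : 0 < x) :
    x * (besselJ ν x * besselYDeriv ν x - besselY ν x * besselJDeriv ν x) = 2 / Real.pi := by
  rw [← (isPhasePair_bessel ν).wronskian_eq hx]
  have hs : √x ≠ 0 := (Real.sqrt_pos.mpr hx).ne'
  have h := Real.sq_sqrt hx.le
  field_simp
  rw [h]
  ring

/-! ### Signs of `J`, `J'` and `J + Y` below the order -/

theorem Gamma_le_Gamma_nat_add {s : ℝ} (hs : 1 ≤ s) (k : ℕ) :
    Real.Gamma s ≤ Real.Gamma (k + s) := by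
  induction k with
  | zero => simp
  | succ k ih =>
    have h1 : 1 ≤ (k : ℝ) + s := by linarith [k.cast_nonneg (α := ℝ)]
    have e : ((k + 1 : ℕ) : ℝ) + s = (k + s) + 1 := by push_cast; ring
    rw [e, Real.Gamma_add_one (by linarith)]
    have h2 : 0 < Real.Gamma (k + s) := Real.Gamma_pos_of_pos (by linarith)
    nlinarith

theorem besselJ_pos_and_le_of_le_one {ν : ℝ} (hν : 0 < ν) {x : ℝ} (hx : 0 < x) (hx1 : x ≤ 1) :
    0 < besselJ ν x ∧ besselJ ν x ≤ (Real.Gamma (ν + 1))⁻¹ * Real.exp 1 := by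
  set a := (Real.Gamma (ν + 1))⁻¹ with ha
  have hG : 0 < Real.Gamma (ν + 1) := Real.Gamma_pos_of_pos (by linarith)
  have ha0 : 0 < a := inv_pos.mpr hG
  set t := (x / 2) ^ 2 with ht
  set p := (x / 2) ^ ν with hp
  have hp0 : 0 < p := by positivity
  have hp1 : p ≤ 1 := Real.rpow_le_one (by positivity) (by linarith) hν.le
  have ht0 : 0 ≤ t := by positivity
  have ht1 : t ≤ 1 / 4 := by rw [ht]; nlinarith
  set f : ℕ → ℝ := fun k => (-1 : ℝ) ^ k / ((k.factorial : ℝ) * Real.Gamma ((k : ℝ) + ν + 1)) *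
    (x / 2) ^ (2 * (k : ℝ) + ν) with hf
  have hE : HasSum (fun k : ℕ => a * p * (t ^ k / k.factorial)) (a * p * Real.exp t) := by
    have := (NormedSpace.expSeries_div_hasSum_exp t).mul_left (a * p)
    rwa [← Real.exp_eq_exp_ℝ] at this
  have habs : ∀ k, |f k| ≤ a * p * (t ^ k / k.factorial) := fun k => by
    have h1 : Real.Gamma (ν + 1) ≤ Real.Gamma ((k : ℝ) + ν + 1) := by
      rw [add_assoc]; exact Gamma_le_Gamma_nat_add (by linarith) k
    have h2 : (x / 2) ^ (2 * (k : ℝ) + ν) = t ^ k * p := by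
      rw [Real.rpow_add (by positivity), ht, ← pow_mul, ← Real.rpow_natCast]
      push_cast; rfl
    have h3 : 0 < Real.Gamma ((k : ℝ) + ν + 1) := hG.trans_le h1
    simp only [hf]
    rw [h2, abs_mul, abs_div, abs_pow, abs_neg, abs_one, one_pow, abs_of_pos (by positivity),
      abs_of_nonneg (by positivity : 0 ≤ t ^ k * p)]
    calc 1 / ((k.factorial : ℝ) * Real.Gamma ((k : ℝ) + ν + 1)) * (t ^ k * p)
        ≤ 1 / ((k.factorial : ℝ) * Real.Gamma (ν + 1)) * (t ^ k * p) := by gcongr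
      _ = a * p * (t ^ k / k.factorial) := by rw [ha]; field_simp
  have hF : HasSum f (besselJ ν x) :=
    (Summable.of_norm_bounded hE.summable habs).hasSum
  have h0 : f 0 = a * p := by
    simp only [hf, ha, hp]
    norm_num
  constructor
  · have h := le_hasSum (hF.add hE) 0 fun k _ => by linarith [neg_abs_le (f k), habs k]
    simp only [h0, pow_zero, Nat.factorial_zero, Nat.cast_one, div_one, mul_one] at h
    have h2 : Real.exp t ≤ 1 / (1 - 1 / 4) :=
      (Real.exp_le_exp.mpr ht1).trans
        (Real.exp_bound_div_one_sub_of_interval (by norm_num) (by norm_num))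
    have h3 : 0 < a * p := by positivity
    nlinarith
  · have h := hasSum_le (fun k => (le_abs_self _).trans (habs k)) hF hE
    refine h.trans ?_
    have h2 : Real.exp t ≤ Real.exp 1 := Real.exp_le_exp.mpr (by linarith)
    calc a * p * Real.exp t ≤ a * 1 * Real.exp 1 := by gcongr
      _ = _ := by ring

/-- By Bessel's equation `(x J')' = (ν² - x²) J / x ≥ 0`. If `x J' = -c < 0` at one point, then `t
J'(t) ≤ -c` to its left, and `J` would grow at least like `-c log t` at `0`, against its boundedness
there. -/
theorem besselJDeriv_nonneg_of_pos {ν b : ℝ} (hν : 0 < ν) (hb : b ≤ ν)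
    (hpos : ∀ x, 0 < x → x < b → 0 < besselJ ν x) {x : ℝ} (hx : 0 < x) (hxb : x < b) :
    0 ≤ besselJDeriv ν x := by
  by_contra! hneg
  set z : ℝ → ℝ := fun x => x * besselJDeriv ν x with hz
  have dz : ∀ t, 0 < t → HasDerivAt z ((ν ^ 2 - t ^ 2) / t * besselJ ν t) t := fun t ht => by
    refine ((hasDerivAt_id t).mul (hasDerivAt_besselJDeriv ν ht)).congr_deriv ?_
    simp only [id]
    field_simp
    ring
  have hmono : MonotoneOn z (Ioo 0 b) := by
    refine monotoneOn_of_deriv_nonneg (convex_Ioo 0 b)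
      (fun t ht => (dz t ht.1).continuousAt.continuousWithinAt) (fun t ht => ?_) fun t ht => ?_
    · rw [interior_Ioo] at ht
      exact (dz t ht.1).differentiableAt.differentiableWithinAt
    · rw [interior_Ioo] at ht
      rw [(dz t ht.1).deriv]
      have h1 := hpos t ht.1 ht.2
      have h2 : t ^ 2 ≤ ν ^ 2 := pow_le_pow_left₀ ht.1.le (ht.2.le.trans hb) 2
      have h3 := ht.1
      exact mul_nonneg (div_nonneg (by linarith) h3.le) h1.le
  set c := -z x with hc
  have hc0 : 0 < c := neg_pos.mpr (mul_neg_of_pos_of_neg hx hneg)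
  have hanti : AntitoneOn (fun t => besselJ ν t + c * Real.log t) (Ioc 0 x) := by
    have hd : ∀ t, 0 < t → HasDerivAt (fun t => besselJ ν t + c * Real.log t)
        (besselJDeriv ν t + c * t⁻¹) t := fun t ht =>
      (hasDerivAt_besselJ ν ht).add ((Real.hasDerivAt_log ht.ne').const_mul c)
    refine antitoneOn_of_deriv_nonpos (convex_Ioc 0 x)
      (fun t ht => (hd t ht.1).continuousAt.continuousWithinAt) (fun t ht => ?_) fun t ht => ?_
    · rw [interior_Ioc] at ht
      exact (hd t ht.1).differentiableAt.differentiableWithinAt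
    · rw [interior_Ioc] at ht
      rw [(hd t ht.1).deriv]
      have h1 := hmono ⟨ht.1, ht.2.trans hxb⟩ ⟨hx, hxb⟩ ht.2.le
      have h2 : besselJDeriv ν t + c * t⁻¹ = (z t - z x) / t := by
        have := ht.1.ne'
        simp only [hz, hc]; field_simp; ring
      rw [h2]
      exact div_nonpos_of_nonpos_of_nonneg (by linarith) ht.1.le
  have hlog : Tendsto (fun t => besselJ ν x + c * Real.log x - c * Real.log t) (𝓝[>] 0) atTop := by
    simp_rw [sub_eq_add_neg]
    exact tendsto_atTop_add_const_left _ _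
      (tendsto_neg_atBot_atTop.comp (Real.tendsto_log_nhdsGT_zero.const_mul_atBot hc0))
  obtain ⟨t, ht1, ht2⟩ := ((hlog.eventually_gt_atTop
    ((Real.Gamma (ν + 1))⁻¹ * Real.exp 1)).and
      (Ioo_mem_nhdsGT (lt_min hx one_pos))).exists
  have h1 := hanti ⟨ht2.1, (ht2.2.trans_le (min_le_left _ _)).le⟩ ⟨hx, le_rfl⟩
    (ht2.2.trans_le (min_le_left _ _)).le
  have h2 := (besselJ_pos_and_le_of_le_one hν ht2.1 (ht2.2.trans_le (min_le_right _ _)).le).2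
  simp only at h1
  linarith

/-- Up to the first point `s` where positivity fails `J` is nondecreasing, so `J(s) ≥ J(1) > 0`. -/
theorem besselJ_pos_of_le_order {ν : ℝ} (hν : 0 < ν) {x : ℝ} (hx : 0 < x) (hxν : x ≤ ν) :
    0 < besselJ ν x := by
  by_contra! hle
  have hx1 : 1 ≤ x := by
    by_contra! hlt
    exact absurd (besselJ_pos_and_le_of_le_one hν hx hlt.le).1 (not_lt.mpr hle)
  have hcont : ContinuousOn (besselJ ν) (Icc 1 x) := fun t ht =>
    (hasDerivAt_besselJ ν (one_pos.trans_le ht.1)).continuousAt.continuousWithinAt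
  set S := Icc 1 x ∩ besselJ ν ⁻¹' Iic 0 with hS
  have hSc : IsClosed S := hcont.preimage_isClosed_of_isClosed isClosed_Icc isClosed_Iic
  have hSb : BddBelow S := ⟨1, fun t ht => ht.1.1⟩
  obtain ⟨hs1, hs2⟩ := hSc.csInf_mem ⟨x, ⟨hx1, le_rfl⟩, hle⟩ hSb
  set s := sInf S with hs
  have hpos : ∀ t, 0 < t → t < s → 0 < besselJ ν t := fun t ht hts => by
    rcases le_or_gt t 1 with h1 | h1
    · exact (besselJ_pos_and_le_of_le_one hν ht h1).1
    · by_contra! h0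
      exact absurd (csInf_le hSb ⟨⟨h1.le, hts.le.trans hs1.2⟩, h0⟩) (not_le.mpr hts)
  have hmono : MonotoneOn (besselJ ν) (Icc 1 s) := by
    refine monotoneOn_of_deriv_nonneg (convex_Icc 1 s)
      (hcont.mono (Icc_subset_Icc le_rfl hs1.2)) (fun t ht => ?_) fun t ht => ?_
    · rw [interior_Icc] at ht
      exact (hasDerivAt_besselJ ν
        (one_pos.trans ht.1)).differentiableAt.differentiableWithinAt
    · rw [interior_Icc] at ht
      rw [(hasDerivAt_besselJ ν (one_pos.trans ht.1)).deriv]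
      exact besselJDeriv_nonneg_of_pos hν (hs1.2.trans hxν) hpos (one_pos.trans ht.1) ht.2
  have h1 := hmono ⟨le_rfl, hs1.1⟩ ⟨hs1.1, le_rfl⟩ hs1.1
  have h2 := (besselJ_pos_and_le_of_le_one hν one_pos le_rfl).1
  exact absurd (h2.trans_le h1) (not_lt.mpr hs2)

/-- By the Wronskian `Y / J` is strictly increasing on `(0, ν]`, and at `ν` it is at most `-1`. -/
theorem besselJ_add_besselY_neg_of_lt_order {ν : ℝ} (hν : 0 < ν) {x : ℝ} (hx : 0 < x)
    (hxν : x < ν) : besselJ ν x + besselY ν x < 0 := by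
  have hJ : ∀ t ∈ Ioc 0 ν, 0 < besselJ ν t := fun t ht => besselJ_pos_of_le_order hν ht.1 ht.2
  have hd : ∀ t ∈ Ioc 0 ν, HasDerivAt (fun t => besselY ν t / besselJ ν t)
      ((besselYDeriv ν t * besselJ ν t - besselY ν t * besselJDeriv ν t) / besselJ ν t ^ 2) t :=
    fun t ht => (hasDerivAt_besselY ν ht.1).div (hasDerivAt_besselJ ν ht.1) (hJ t ht).ne'
  have hmono : StrictMonoOn (fun t => besselY ν t / besselJ ν t) (Ioc 0 ν) := by
    refine strictMonoOn_of_deriv_pos (convex_Ioc 0 ν)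
      (fun t ht => (hd t ht).continuousAt.continuousWithinAt) fun t ht => ?_
    rw [interior_Ioc] at ht
    have ht' : t ∈ Ioc 0 ν := ⟨ht.1, ht.2.le⟩
    rw [(hd t ht').deriv]
    have hw := besselJ_wronskian ν ht.1
    have h1 : 0 < t * (besselJ ν t * besselYDeriv ν t - besselY ν t * besselJDeriv ν t) := by
      rw [hw]; positivity
    have h2 := pos_of_mul_pos_right h1 ht.1.le
    refine div_pos (by linarith) (pow_pos (hJ t ht') 2)
  have h1 := hmono ⟨hx, hxν.le⟩ ⟨hν, le_rfl⟩ hxν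
  have h2 : besselY ν ν / besselJ ν ν ≤ -1 := by
    rw [div_le_iff₀ (hJ ν ⟨hν, le_rfl⟩)]
    linarith [besselJ_add_besselY_self_nonpos hν]
  have h3 := h1.trans_le h2
  rw [div_lt_iff₀ (hJ x ⟨hx, hxν.le⟩)] at h3
  linarith

theorem order_le_besselX {ν : ℝ} (hν : 0 < ν) : ν ≤ besselX ν := by
  -- Nonemptiness matters, since the infimum of the empty set would be `0`. A zero is found between
  -- `ν`, where `J + Y ≤ 0`, and a point where it is positive.
  refine le_csInf ?_ fun x hx => ?_
  · obtain ⟨b, hb, hb'⟩ := exists_besselJ_add_besselY_pos ν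
    have hc : ContinuousOn (fun x => besselJ ν x + besselY ν x) (Ioi 0) := fun t ht =>
      ((hasDerivAt_besselJ ν ht).add
        (hasDerivAt_besselY ν ht)).continuousAt.continuousWithinAt
    obtain ⟨c, hc1, hc2⟩ := isPreconnected_Ioi.intermediate_value (mem_Ioi.mpr hν) (mem_Ioi.mpr hb)
      hc ⟨besselJ_add_besselY_self_nonpos hν, hb'.le⟩
    exact ⟨c, hc1, hc2⟩
  · by_contra! hlt
    exact (besselJ_add_besselY_neg_of_lt_order hν hx.1 hlt).ne hx.2

theorem neg_two_mul_besselJ_mul_besselY_le {ν : ℝ} (hν : 0 < ν) {x : ℝ} (hx : 0 < x)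
    (hxν : x ≤ ν) :
    -2 * x * besselJ ν x * besselY ν x ≤
      -2 * ν * besselJ ν ν * besselY ν ν + 4 * ν / Real.pi := by
  have hd : ∀ t, 0 < t → HasDerivAt
      (fun t => -2 * (t * (besselJ ν t * besselY ν t)) + 4 / Real.pi * t)
      (-2 * (besselJ ν t * besselY ν t) - 4 * t * (besselJDeriv ν t * besselY ν t)) t :=
    fun t ht => by
      have h := (((hasDerivAt_id t).mul ((hasDerivAt_besselJ ν ht).mul
        (hasDerivAt_besselY ν ht))).const_mul (-2)).add
          ((hasDerivAt_id t).const_mul (4 / Real.pi))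
      refine h.congr_deriv ?_
      simp only [id, Pi.mul_apply]
      -- The Wronskian trades `J Y'` for `J' Y` at the cost of the constant `4/π`, which the added
      -- linear term absorbs.
      linear_combination -2 * besselJ_wronskian ν ht
  have hmono : MonotoneOn (fun t => -2 * (t * (besselJ ν t * besselY ν t)) + 4 / Real.pi * t)
      (Ioc 0 ν) := by
    refine monotoneOn_of_deriv_nonneg (convex_Ioc 0 ν)
      (fun t ht => (hd t ht.1).continuousAt.continuousWithinAt) (fun t ht => ?_) fun t ht => ?_
    · rw [interior_Ioc] at ht
      exact (hd t ht.1).differentiableAt.differentiableWithinAt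
    · rw [interior_Ioc] at ht
      rw [(hd t ht.1).deriv]
      have h1 := besselJ_pos_of_le_order hν ht.1 ht.2.le
      have h2 := besselJ_add_besselY_neg_of_lt_order hν ht.1 ht.2
      have h3 := besselJDeriv_nonneg_of_pos hν le_rfl
        (fun y hy hyν => besselJ_pos_of_le_order hν hy hyν.le) ht.1 ht.2
      have h4 : besselY ν t ≤ 0 := by linarith
      have h5 := mul_nonpos_of_nonneg_of_nonpos h1.le h4
      have h6 := mul_nonpos_of_nonneg_of_nonpos ht.1.le (mul_nonpos_of_nonneg_of_nonpos h3 h4)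
      linarith
  have h := hmono ⟨hx, hxν⟩ ⟨hν, le_rfl⟩ hxν
  have h2 : 0 ≤ 4 / Real.pi * x := by positivity
  have h3 : 4 * ν / Real.pi = 4 / Real.pi * ν := by ring
  simp only at h
  rw [h3]
  linarith

/-! ### The modulus function -/

theorem besselModulus_sq_of_le {ν x : ℝ} (h : x ≤ besselX ν) :
    besselModulus ν x ^ 2 = 2 * |besselY ν x| * |besselJ ν x| := by
  rw [besselModulus, if_pos h, Real.sq_sqrt (by positivity)]

theorem besselModulus_sq_le (ν x : ℝ) :
    besselModulus ν x ^ 2 ≤ besselJ ν x ^ 2 + besselY ν x ^ 2 := by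
  by_cases h : x ≤ besselX ν
  · rw [besselModulus_sq_of_le h, ← sq_abs (besselJ ν x), ← sq_abs (besselY ν x)]
    nlinarith [sq_nonneg (|besselY ν x| - |besselJ ν x|)]
  · rw [besselModulus, if_neg h, Real.sq_sqrt (by positivity)]

theorem mul_besselModulus_sq_le {α x : ℝ} (hα : -(1 / 2) ≤ α) (hx : 0 < x) :
    x * besselModulus α x ^ 2 ≤ modulusBound α := by
  have hle := mul_le_mul_of_nonneg_left (besselModulus_sq_le α x) hx.le
  rw [modulusBound]
  split_ifs with h
  · exact hle.trans (mul_besselJ_sq_add_besselY_sq_le h hx)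
  · have hα2 : 1 / 2 < α := by
      by_contra! hlt
      exact h (abs_le.mpr ⟨hα, hlt⟩)
    have hα0 : 0 < α := by linarith
    -- The split is at `α`, not at `X_α`: between the two the bound `2|Y||J| ≤ J² + Y²` already
    -- suffices.
    rcases lt_or_ge x α with hxα | hxα
    · refine le_max_of_le_left ?_
      rw [besselModulus_sq_of_le (hxα.le.trans (order_le_besselX hα0))]
      have h1 := besselJ_pos_of_le_order hα0 hx hxα.le
      have h2 := besselJ_add_besselY_neg_of_lt_order hα0 hx hxα
      rw [abs_of_pos h1, abs_of_neg (by linarith)]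
      have h3 := neg_two_mul_besselJ_mul_besselY_le hα0 hx hxα.le
      linarith
    · exact le_max_of_le_right
        (hle.trans (antitoneOn_mul_besselJ_sq_add_besselY_sq hα2 hα0 hx hxα))

theorem proposition1 (α : ℝ) (hα : -(1 / 2) ≤ α) :
    BddAbove ((fun x : ℝ => x * besselModulus α x ^ 2) '' Set.Ioi 0) ∧
      sSup ((fun x : ℝ => x * besselModulus α x ^ 2) '' Set.Ioi 0) ≤ modulusBound α := by
  have h : ∀ y ∈ (fun x : ℝ => x * besselModulus α x ^ 2) '' Set.Ioi 0, y ≤ modulusBound α := by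
    rintro _ ⟨x, hx, rfl⟩
    exact mul_besselModulus_sq_le hα hx
  exact ⟨⟨_, h⟩, csSup_le (Set.nonempty_Ioi.image _) h⟩
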